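/- **Theorem 1 (Equivalence of the approximate GKP code states).** Consider one bosonic mode with Hilbert space $L^2(\mathbb R)$ (position wave functions), $(\hat q\psi)(x)=x\psi(x)$, $\hat p=-i\,d/dx$, $\hat a=(\hat q+i\hat p)/\sqrt2$, $\hat n=\hat a^\dagger\hat a$, $\hat X(r)=e^{-ir\hat p}$, $\hat Z(r)=e^{ir\hat q}$, $\hat V(r_1,r_2)=e^{-ir_1r_2/2}\hat Z(r_1)\hat X(r_2)$, $\hat S(\xi)=e^{i\xi(\hat q\hat p+\hat p\hat q)/2}$ (so that $(\hat S(\xi)\psi)(x)=e^{\xi/2}\psi(e^{\xi}x)$), and Fock states $|n\rangle_f$, where $|0\rangle_f$ has the wave function $\pi^{-1/4}e^{-x^2/2}$. Let $d\ge1$, $j\in\{0,\dots,d-1\}$, $\alpha_d=\sqrt{2\pi/d}$, and let $$|j^{(\mathrm{ideal})}\rangle=\sqrt{\alpha_d d}\sum_{s\in\mathbb Z}|\alpha_d(ds+j)\rangle_{\hat q}$$ be the (tempered-distribution) square-lattice ideal code state, where $|y\rangle_{\hat q}$ is the Dirac delta at $y$. With positive normalization constants $N$ that make the states unit vectors, define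 $$|j^{(1)}_{\kappa,\Delta}\rangle=\frac1{\sqrt{N^{(1)}_{\kappa,\Delta,j}}}\sum_{s\in\mathbb Z}e^{-\frac12\kappa^2\alpha_d^2(ds+j)^2}\hat X(\alpha_d(ds+j))\hat S(-\ln\Delta)|0\rangle_f\qquad(\kappa,\Delta>0),$$ $$|j^{(2)}_{\gamma,\delta}\rangle=\frac1{\sqrt{N^{(2)}_{\gamma,\delta,j}}}\iint\frac{dr_1dr_2}{2\pi\gamma\delta}\,e^{-\frac{r_1^2}{2\gamma^2}-\frac{r_2^2}{2\delta^2}}\hat V(r_1,r_2)|j^{(\mathrm{ideal})}\rangle\qquad(0<\gamma\delta<2),$$ $$|j^{(3)}_\beta\rangle=\frac1{\sqrt{N^{(3)}_{\beta,j}}}e^{-\beta(\hat n+\frac12)}|j^{(\mathrm{ideal})}\rangle\qquad(\beta>0),$$ where the integral is understood weakly, that is, tested against Schwartz functions, and $e^{-\beta(\hat n+1/2)}$ acts diagonally in the Fock basis. Put $\lambda(\gamma,\delta)=1+\gamma^2\delta^2/4$. Let $\beta>0$, and let $\kappa,\Delta>0$ and real $\gamma,\delta$ with $\gamma\delta>0$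 satisfy $$\gamma^2=\delta^2=2\tanh\frac\beta2,\qquad \kappa^2=\frac{\gamma^2}{\lambda(\gamma,\delta)},\qquad \Delta^2=\frac{\delta^2}{\lambda(\gamma,\delta)}\Bigl(1-\frac{\gamma^2\delta^2}{2\lambda(\gamma,\delta)}\Bigr)^{-2}.$$ Then $\gamma\delta<2$, $\kappa^2=\tanh\beta$ and $\Delta^2=\sinh\beta\cosh\beta$; the series defining the ideal state converges in the space of tempered distributions; all three approximate states are well defined unit vectors of $L^2(\mathbb R)$ (the series and the weak integral converge, and the sums and the integral are non-zero vectors of $L^2(\mathbb R)$); and $$\hat S\!\left(\ln\sqrt{1+\kappa^2\Delta^2}\right)|j^{(1)}_{\kappa,\Delta}\rangle=|j^{(2)}_{\gamma,\delta}\rangle=|j^{(3)}_\beta\rangle .$$ -/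

import Mathlib

open MeasureTheory Filter Topology
open scoped SchwartzMap ENNReal

noncomputable section

namespace GKP

/-! ### One bosonic mode in the position representation

The Hilbert space is `L²(ℝ; ℂ)`, a vector being its position wave function. Generalized
(non-normalizable) kets are tempered distributions: the ket with formal wave function `T(x)`
is the functional `f ↦ ∫ T(x) f(x) dx`. -/

/-- The Hilbert space of one mode. -/
abbrev H : Type := Lp ℂ 2 (volume : Measure ℝ)

/-- A Schwartz function as a vector of the Hilbert space. -/
def ket (f : 𝓢(ℝ, ℂ)) : H := f.toLp 2

/-! ### Canonical operators on the Schwartz space -/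

/-- The position operator `(q̂ f)(x) = x f(x)`. -/
def posOp : 𝓢(ℝ, ℂ) →L[ℂ] 𝓢(ℝ, ℂ) := SchwartzMap.smulLeftCLM ℂ (fun x : ℝ => (x : ℂ))

/-- The momentum operator `p̂ f = -i f'`. -/
def momOp : 𝓢(ℝ, ℂ) →L[ℂ] 𝓢(ℝ, ℂ) := (-Complex.I) • SchwartzMap.derivCLM ℂ ℂ

/-- The annihilation operator `â = (q̂ + i p̂)/√2`. -/
def annOp : 𝓢(ℝ, ℂ) →L[ℂ] 𝓢(ℝ, ℂ) :=
  ((Real.sqrt 2 : ℝ) : ℂ)⁻¹ • (posOp + Complex.I • momOp)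

/-- The creation operator `â† = (q̂ - i p̂)/√2`. -/
def creOp : 𝓢(ℝ, ℂ) →L[ℂ] 𝓢(ℝ, ℂ) :=
  ((Real.sqrt 2 : ℝ) : ℂ)⁻¹ • (posOp - Complex.I • momOp)

/-- The number operator `n̂ = â† â`. -/
def numOp : 𝓢(ℝ, ℂ) →L[ℂ] 𝓢(ℝ, ℂ) := creOp ∘L annOp

theorem posOp_apply (f : 𝓢(ℝ, ℂ)) (x : ℝ) : posOp f x = x * f x := by
  have h : (fun x : ℝ => (x : ℂ)).HasTemperateGrowth := by fun_prop
  rw [posOp, SchwartzMap.smulLeftCLM_apply_apply h, smul_eq_mul]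

theorem momOp_apply (f : 𝓢(ℝ, ℂ)) (x : ℝ) : momOp f x = -Complex.I * deriv f x := by
  simp [momOp]

theorem deriv_posOp (f : 𝓢(ℝ, ℂ)) (x : ℝ) : deriv (posOp f) x = f x + x * deriv f x := by
  have h1 : (posOp f : ℝ → ℂ) = Complex.ofRealCLM * f := funext (posOp_apply f)
  rw [h1, ((Complex.ofRealCLM.hasDerivAt (x := x)).mul f.differentiableAt.hasDerivAt).deriv]
  simp

/-! ### Displacements and squeezing -/

/-- `X̂(r) = exp(-i r p̂)` on the Schwartz space: `(X̂(r) f)(x) = f(x - r)`. -/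
def dispX (r : ℝ) : 𝓢(ℝ, ℂ) →L[ℂ] 𝓢(ℝ, ℂ) := SchwartzMap.compSubConstCLM ℂ r

/-- `Ẑ(r) = exp(i r q̂)` on the Schwartz space: `(Ẑ(r) f)(x) = e^{i r x} f(x)`. -/
def dispZ (r : ℝ) : 𝓢(ℝ, ℂ) →L[ℂ] 𝓢(ℝ, ℂ) :=
  SchwartzMap.smulLeftCLM ℂ (fun x : ℝ => Complex.exp (Complex.I * r * x))

/-- `Ŝ(ξ) = exp(i ξ (q̂ p̂ + p̂ q̂)/2)` on the Schwartz space: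
`(Ŝ(ξ) f)(x) = e^{ξ/2} f(e^ξ x)`. -/
def squeeze (ξ : ℝ) : 𝓢(ℝ, ℂ) →L[ℂ] 𝓢(ℝ, ℂ) :=
  ((Real.exp (ξ / 2) : ℝ) : ℂ) • SchwartzMap.compCLMOfContinuousLinearEquiv ℂ
    (ContinuousLinearEquiv.unitsEquivAut ℝ (Units.mk0 (Real.exp ξ) (Real.exp_ne_zero ξ)))

theorem dispX_apply (r : ℝ) (f : 𝓢(ℝ, ℂ)) (x : ℝ) : dispX r f x = f (x - r) := by
  simp [dispX]

theorem hasTemperateGrowth_phase (r : ℝ) :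
    (fun x : ℝ => Complex.exp (Complex.I * r * x)).HasTemperateGrowth := by
  have hd : deriv (fun x : ℝ => Complex.exp (Complex.I * r * x)) =
      fun x : ℝ => (Complex.I * r) * Complex.exp (Complex.I * r * x) := by
    funext x
    have h1 : HasDerivAt (fun y : ℝ => Complex.I * r * (y : ℂ)) (Complex.I * r) x := by
      simpa using (Complex.ofRealCLM.hasDerivAt (x := x)).const_mul (Complex.I * (r : ℂ))
    rw [h1.cexp.deriv, mul_comm]
  have hn : ∀ n : ℕ, iteratedDeriv n (fun x : ℝ => Complex.exp (Complex.I * r * x)) =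
      fun x : ℝ => (Complex.I * r) ^ n * Complex.exp (Complex.I * r * x) := by
    intro n
    induction n with
    | zero => simp
    | succ n ih =>
      rw [iteratedDeriv_succ, ih]
      funext x
      rw [deriv_const_mul_field, hd]
      ring
  refine ⟨(contDiff_const.mul Complex.ofRealCLM.contDiff).cexp, fun n => ⟨0, |r| ^ n, fun x => ?_⟩⟩
  rw [norm_iteratedFDeriv_eq_norm_iteratedDeriv, hn]
  have : Complex.I * r * x = ((r * x : ℝ) : ℂ) * Complex.I := by push_cast; ring
  simp [this, Complex.norm_exp_ofReal_mul_I, -Complex.ofReal_mul]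

theorem dispZ_apply (r : ℝ) (f : 𝓢(ℝ, ℂ)) (x : ℝ) :
    dispZ r f x = Complex.exp (Complex.I * r * x) * f x := by
  rw [dispZ, SchwartzMap.smulLeftCLM_apply_apply (hasTemperateGrowth_phase r), smul_eq_mul]

theorem squeeze_apply (ξ : ℝ) (f : 𝓢(ℝ, ℂ)) (x : ℝ) :
    squeeze ξ f x = (Real.exp (ξ / 2) : ℝ) * f (Real.exp ξ * x) := by
  simp [squeeze, mul_comm]

/-- `X̂` is the group generated by `-i p̂`. -/
theorem hasDerivAt_dispX (f : 𝓢(ℝ, ℂ)) (r x : ℝ) :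
    HasDerivAt (fun t : ℝ => dispX t f x) (-Complex.I * momOp (dispX r f) x) r := by
  have h1 : HasDerivAt f (deriv f (x - r)) (x - r) := f.differentiableAt.hasDerivAt
  have h2 : HasDerivAt (fun t : ℝ => x - t) (-1) r := by
    simpa using (hasDerivAt_id r).const_sub x
  have h3 := h1.scomp r h2
  have h4 : deriv (dispX r f) x = deriv f (x - r) := by
    have : (dispX r f : ℝ → ℂ) = fun y => f (y - r) := funext (dispX_apply r f)
    rw [this, deriv_comp_sub_const]
  have h5 : (fun t : ℝ => dispX t f x) = f ∘ fun t => x - t := by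
    funext t
    exact dispX_apply t f x
  rw [momOp_apply, h4, h5]
  refine h3.congr_deriv ?_
  rw [← mul_assoc]
  simp

/-- `Ẑ` is the group generated by `i q̂`. -/
theorem hasDerivAt_dispZ (f : 𝓢(ℝ, ℂ)) (r x : ℝ) :
    HasDerivAt (fun t : ℝ => dispZ t f x) (Complex.I * posOp (dispZ r f) x) r := by
  have h1 : HasDerivAt (fun y : ℝ => Complex.I * (y : ℂ) * (x : ℂ)) (Complex.I * x) r := by
    simpa using
      ((Complex.ofRealCLM.hasDerivAt (x := r)).const_mul Complex.I).mul_const (x : ℂ)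
  have h2 := h1.cexp.mul_const (f x)
  have h3 : (fun t : ℝ => dispZ t f x) = fun t : ℝ => Complex.exp (Complex.I * t * x) * f x :=
    funext fun t => dispZ_apply t f x
  rw [posOp_apply, dispZ_apply, h3]
  refine h2.congr_deriv ?_
  ring

/-- `Ŝ` is the group generated by `i (q̂ p̂ + p̂ q̂)/2`. -/
theorem hasDerivAt_squeeze (f : 𝓢(ℝ, ℂ)) (ξ x : ℝ) :
    HasDerivAt (fun t : ℝ => squeeze t f x)
      (Complex.I * ((posOp (momOp (squeeze ξ f)) + momOp (posOp (squeeze ξ f))) x / 2)) ξ := by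
  have he : ∀ t : ℝ, HasDerivAt (fun t : ℝ => ((Real.exp (t / 2) : ℝ) : ℂ))
      (((Real.exp (t / 2) * (1 / 2) : ℝ)) : ℂ) t := fun t =>
    (((hasDerivAt_id t).div_const 2).exp).ofReal_comp
  have h1 : HasDerivAt (fun t : ℝ => Real.exp t * x) (Real.exp ξ * x) ξ :=
    (Real.hasDerivAt_exp ξ).mul_const x
  have h2 : HasDerivAt f (deriv f (Real.exp ξ * x)) (Real.exp ξ * x) :=
    f.differentiableAt.hasDerivAt
  have h3 := (he ξ).mul (h2.scomp ξ h1)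
  have hs : ∀ y, HasDerivAt (squeeze ξ f)
      ((Real.exp (ξ / 2) : ℝ) * (Real.exp ξ • deriv f (Real.exp ξ * y))) y := by
    intro y
    have a1 : HasDerivAt (fun t : ℝ => Real.exp ξ * t) (Real.exp ξ) y := by
      simpa using (hasDerivAt_id y).const_mul (Real.exp ξ)
    have a2 : HasDerivAt f (deriv f (Real.exp ξ * y)) (Real.exp ξ * y) :=
      f.differentiableAt.hasDerivAt
    have a3 := (a2.scomp y a1).const_mul ((Real.exp (ξ / 2) : ℝ) : ℂ)
    have : (squeeze ξ f : ℝ → ℂ) =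
        fun y => ((Real.exp (ξ / 2) : ℝ) : ℂ) * (f ∘ fun t => Real.exp ξ * t) y :=
      funext (squeeze_apply ξ f)
    rw [this]
    exact a3
  have hq : deriv (posOp (squeeze ξ f)) x = squeeze ξ f x + x * deriv (squeeze ξ f) x :=
    deriv_posOp _ x
  have h5 : (fun t : ℝ => squeeze t f x) =
      fun t => ((Real.exp (t / 2) : ℝ) : ℂ) * (f ∘ fun t => Real.exp t * x) t :=
    funext fun t => squeeze_apply t f x
  rw [add_apply, posOp_apply, momOp_apply, momOp_apply, hq, (hs x).deriv, h5]
  refine h3.congr_deriv ?_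
  rw [squeeze_apply]
  simp only [Function.comp_apply, Complex.real_smul]
  push_cast
  linear_combination (Complex.exp (ξ / 2) * f (Real.exp ξ * x) / 2 +
    Complex.exp (ξ / 2) * Complex.exp ξ * x * deriv f (Real.exp ξ * x)) * Complex.I_sq

theorem memLp_squeeze (ξ : ℝ) (ψ : H) :
    MemLp (fun x : ℝ => ((Real.exp (ξ / 2) : ℝ) : ℂ) * ψ (Real.exp ξ * x)) 2 volume := by
  have h1 : MemLp ψ 2 (Measure.map (fun x : ℝ => Real.exp ξ * x) volume) := by
    rw [Real.map_volume_mul_left (Real.exp_ne_zero ξ)]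
    exact (Lp.memLp ψ).smul_measure ENNReal.ofReal_ne_top
  exact (h1.comp_of_map (by fun_prop)).const_mul _

/-- The unitary squeezing operator on the Hilbert space, `(Ŝ(ξ) ψ)(x) = e^{ξ/2} ψ(e^ξ x)`. -/
def squeezeH (ξ : ℝ) (ψ : H) : H := (memLp_squeeze ξ ψ).toLp _

theorem squeezeH_ket (ξ : ℝ) (f : 𝓢(ℝ, ℂ)) : squeezeH ξ (ket f) = ket (squeeze ξ f) := by
  have hq : Measure.QuasiMeasurePreserving (fun x : ℝ => Real.exp ξ * x) volume volume :=
    ⟨by fun_prop, by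
      rw [Real.map_volume_mul_left (Real.exp_ne_zero ξ)]
      exact Measure.smul_absolutelyContinuous⟩
  have h := hq.ae_eq_comp (SchwartzMap.coeFn_toLp f 2 volume)
  refine Lp.ext ?_
  filter_upwards [(memLp_squeeze ξ (ket f)).coeFn_toLp,
    SchwartzMap.coeFn_toLp (squeeze ξ f) 2 volume, h] with x h1 h2 h3
  simp only [Function.comp_apply] at h3
  rw [squeezeH, h1, ket, ket, h2, squeeze_apply, h3]

theorem norm_squeezeH (ξ : ℝ) (ψ : H) : ‖squeezeH ξ ψ‖ = ‖ψ‖ := by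
  have hae : AEStronglyMeasurable (ψ : ℝ → ℂ)
      (Measure.map (fun x : ℝ => Real.exp ξ * x) volume) := by
    rw [Real.map_volume_mul_left (Real.exp_ne_zero ξ)]
    exact (Lp.aestronglyMeasurable ψ).smul_measure _
  have h := eLpNorm_map_measure (p := 2) hae (by fun_prop)
  rw [Real.map_volume_mul_left (Real.exp_ne_zero ξ),
    eLpNorm_smul_measure_of_ne_top (by norm_num)] at h
  rw [squeezeH, Lp.norm_toLp, Lp.norm_def]
  have h' : eLpNorm (fun x : ℝ => ((Real.exp (ξ / 2) : ℝ) : ℂ) * ψ (Real.exp ξ * x)) 2 volume =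
      ‖((Real.exp (ξ / 2) : ℝ) : ℂ)‖ₑ *
        eLpNorm ((ψ : ℝ → ℂ) ∘ fun x : ℝ => Real.exp ξ * x) 2 volume :=
    eLpNorm_const_smul ((Real.exp (ξ / 2) : ℝ) : ℂ)
      ((ψ : ℝ → ℂ) ∘ fun x : ℝ => Real.exp ξ * x) 2 volume
  rw [h', ← h, smul_eq_mul, ENNReal.toReal_mul, ENNReal.toReal_mul, ← ENNReal.toReal_rpow,
    ENNReal.toReal_ofReal (abs_nonneg _), abs_of_pos (by positivity), ← mul_assoc]
  have : (‖((Real.exp (ξ / 2) : ℝ) : ℂ)‖ₑ).toReal * (Real.exp ξ)⁻¹ ^ (1 / (2 : ℝ≥0∞)).toReal = 1 := by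
    rw [toReal_enorm, Complex.norm_real, Real.norm_of_nonneg (Real.exp_pos _).le,
      ← Real.exp_neg, ← Real.exp_mul, ← Real.exp_add]
    simp
    ring
  rw [this, one_mul]

/-- `X̂(r)` on tempered distributions, the transpose of `X̂(-r)`; formally `T(x) ↦ T(x - r)`. -/
def dispXDist (r : ℝ) : 𝓢'(ℝ, ℂ) →L[ℂ] 𝓢'(ℝ, ℂ) :=
  PointwiseConvergenceCLM.precomp ℂ (dispX (-r))

/-- `Ẑ(r)` on tempered distributions, its own transpose; formally `T(x) ↦ e^{i r x} T(x)`. -/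
def dispZDist (r : ℝ) : 𝓢'(ℝ, ℂ) →L[ℂ] 𝓢'(ℝ, ℂ) :=
  PointwiseConvergenceCLM.precomp ℂ (dispZ r)

/-- The Weyl-Heisenberg displacement `V̂(r) = exp(-i r_p r_q / 2) Ẑ(r_p) X̂(r_q)`,
`r = (r_p, r_q)`, on tempered distributions. -/
def dispV (r : ℝ × ℝ) : 𝓢'(ℝ, ℂ) →L[ℂ] 𝓢'(ℝ, ℂ) :=
  Complex.exp (-Complex.I * r.1 * r.2 / 2) • (dispZDist r.1 ∘L dispXDist r.2)

/-! ### Fock states -/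

theorem gaussian_decay (k n : ℕ) : ∃ C : ℝ, ∀ x : ℝ,
    ‖x‖ ^ k * ‖iteratedFDeriv ℝ n (fun y : ℝ => Real.exp (-(y ^ 2 / 2))) x‖ ≤ C := by
  have hb : ∀ m : ℕ, ∃ C : ℝ, ∀ x : ℝ, |x| ^ m * Real.exp (-(x ^ 2 / 2)) ≤ C := by
    intro m
    refine ⟨1 + 2 ^ m * m.factorial, fun x => ?_⟩
    have h1 : |x| ^ m ≤ 1 + (x ^ 2) ^ m := by
      rw [← sq_abs, ← pow_mul, mul_comm 2 m, pow_mul]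
      nlinarith [sq_nonneg (|x| ^ m - 1), sq_nonneg (|x| ^ m)]
    have h2 : (x ^ 2) ^ m ≤ 2 ^ m * m.factorial * Real.exp (x ^ 2 / 2) := by
      have := Real.pow_div_factorial_le_exp (x ^ 2 / 2) (by positivity) m
      rw [div_pow, div_div, div_le_iff₀ (by positivity)] at this
      linarith
    have h3 : Real.exp (x ^ 2 / 2) * Real.exp (-(x ^ 2 / 2)) = 1 := by
      rw [← Real.exp_add]; simp
    have h4 : Real.exp (-(x ^ 2 / 2)) ≤ 1 := by
      rw [Real.exp_le_one_iff]; linarith [sq_nonneg x]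
    have h5 : 0 < Real.exp (-(x ^ 2 / 2)) := Real.exp_pos _
    calc |x| ^ m * Real.exp (-(x ^ 2 / 2))
        ≤ (1 + 2 ^ m * m.factorial * Real.exp (x ^ 2 / 2)) * Real.exp (-(x ^ 2 / 2)) := by
          gcongr; linarith
      _ = Real.exp (-(x ^ 2 / 2)) + 2 ^ m * m.factorial := by
          rw [add_mul, mul_assoc, h3]; ring
      _ ≤ _ := by linarith
  choose C hC using hb
  refine ⟨∑ i ∈ Finset.range ((Polynomial.hermite n).natDegree + 1),
    |((Polynomial.hermite n).coeff i : ℝ)| * C (k + i), fun x => ?_⟩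
  rw [norm_iteratedFDeriv_eq_norm_iteratedDeriv, iteratedDeriv_eq_iterate,
    Polynomial.deriv_gaussian_eq_hermite_mul_gaussian, norm_mul, norm_mul, norm_pow, norm_neg,
    norm_one, one_pow, one_mul, Real.norm_of_nonneg (Real.exp_pos _).le,
    Polynomial.aeval_eq_sum_range, Real.norm_eq_abs]
  calc |x| ^ k * (‖∑ i ∈ Finset.range ((Polynomial.hermite n).natDegree + 1),
          (Polynomial.hermite n).coeff i • x ^ i‖ * Real.exp (-(x ^ 2 / 2)))
      ≤ |x| ^ k * ((∑ i ∈ Finset.range ((Polynomial.hermite n).natDegree + 1),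
          |((Polynomial.hermite n).coeff i : ℝ)| * |x| ^ i) * Real.exp (-(x ^ 2 / 2))) := by
        gcongr
        refine (norm_sum_le _ _).trans (le_of_eq (Finset.sum_congr rfl fun i _ => ?_))
        rw [zsmul_eq_mul, norm_mul, norm_pow, Real.norm_eq_abs, Real.norm_eq_abs]
    _ = ∑ i ∈ Finset.range ((Polynomial.hermite n).natDegree + 1),
          |((Polynomial.hermite n).coeff i : ℝ)| *
            (|x| ^ (k + i) * Real.exp (-(x ^ 2 / 2))) := by
        rw [Finset.sum_mul, Finset.mul_sum]
        exact Finset.sum_congr rfl fun i _ => by rw [pow_add]; ring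
    _ ≤ _ := by
        gcongr with i
        exact hC (k + i) x

/-- The Gaussian `e^{-x²/2}` as a Schwartz function. -/
def gaussian : 𝓢(ℝ, ℝ) where
  toFun y := Real.exp (-(y ^ 2 / 2))
  smooth' := by fun_prop
  decay' := gaussian_decay

/-- The vacuum `|0⟩_f`, with wave function `π^{-1/4} e^{-x²/2}`. -/
def vacuum : 𝓢(ℝ, ℂ) :=
  ((Real.pi ^ (-(1 / 4) : ℝ) : ℝ) : ℂ) • SchwartzMap.postcompCLM (𝕜 := ℝ) Complex.ofRealCLM gaussian

theorem vacuum_apply (x : ℝ) :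
    vacuum x = ((Real.pi ^ (-(1 / 4) : ℝ) * Real.exp (-(x ^ 2 / 2)) : ℝ) : ℂ) := by
  have h : gaussian x = Real.exp (-(x ^ 2 / 2)) := rfl
  simp [vacuum, h]

/-- The Fock state `|n⟩_f = (n!)^{-1/2} (â†)^n |0⟩_f`. -/
def fock (n : ℕ) : 𝓢(ℝ, ℂ) :=
  ((Real.sqrt n.factorial : ℝ) : ℂ)⁻¹ • (creOp^[n]) vacuum

theorem annOp_vacuum : annOp vacuum = 0 := by
  ext x
  have h : HasDerivAt (fun y : ℝ => Real.pi ^ (-(1 / 4) : ℝ) * Real.exp (-(y ^ 2 / 2)))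
      (Real.pi ^ (-(1 / 4) : ℝ) * (Real.exp (-(x ^ 2 / 2)) * -x)) x := by
    have := (((hasDerivAt_pow 2 x).div_const 2).neg.exp).const_mul (Real.pi ^ (-(1 / 4) : ℝ))
    refine this.congr_deriv ?_
    simp
  have hv : (vacuum : ℝ → ℂ) =
      fun y => ((Real.pi ^ (-(1 / 4) : ℝ) * Real.exp (-(y ^ 2 / 2)) : ℝ) : ℂ) :=
    funext vacuum_apply
  have hd : deriv vacuum x = -x * vacuum x := by
    rw [hv, h.ofReal_comp.deriv]
    push_cast
    ring
  have : (posOp + Complex.I • momOp) vacuum x = 0 := by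
    simp only [add_apply, smul_apply,
      add_apply, smul_apply, posOp_apply, momOp_apply, hd, smul_eq_mul]
    linear_combination (x * vacuum x) * Complex.I_sq
  rw [annOp, smul_apply, smul_apply, this]
  simp

/-- The canonical commutation relation `[â, â†] = 1`. -/
theorem annOp_creOp (f : 𝓢(ℝ, ℂ)) : annOp (creOp f) = creOp (annOp f) + f := by
  have hc : posOp (momOp f) - momOp (posOp f) = Complex.I • f := by
    ext x
    have h2 := deriv_posOp f x
    rw [sub_apply, posOp_apply, momOp_apply, momOp_apply, h2, smul_apply,
      smul_eq_mul]
    ring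
  have h2 : ((Real.sqrt 2 : ℝ) : ℂ)⁻¹ * ((Real.sqrt 2 : ℝ) : ℂ)⁻¹ = 1 / 2 := by
    rw [← mul_inv, ← Complex.ofReal_mul, Real.mul_self_sqrt (by norm_num)]
    norm_num
  ext x
  have hx := congrArg (fun g : 𝓢(ℝ, ℂ) => g x) hc
  simp only [sub_apply, smul_apply, smul_eq_mul] at hx
  simp only [annOp, creOp, add_apply, sub_apply,
    smul_apply, map_smul, map_add, map_sub, add_apply,
    sub_apply, smul_apply, smul_eq_mul]
  linear_combination (-2 * Complex.I * (posOp (momOp f) x - momOp (posOp f) x)) * h2 -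
    Complex.I * hx - f x * Complex.I_sq

/-- Fock states are the eigenstates of the number operator. -/
theorem numOp_fock (n : ℕ) : numOp (fock n) = (n : ℂ) • fock n := by
  have h : ∀ n : ℕ, numOp ((creOp^[n]) vacuum) = (n : ℂ) • (creOp^[n]) vacuum := by
    intro n
    induction n with
    | zero => simp [numOp, annOp_vacuum]
    | succ n ih =>
      rw [numOp, ContinuousLinearMap.comp_apply] at ih
      rw [Function.iterate_succ_apply', numOp, ContinuousLinearMap.comp_apply, annOp_creOp, ih,
        map_add, map_smul, Nat.cast_succ, add_smul, one_smul]
  rw [fock, map_smul, h, smul_comm]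

/-- Fock wave functions are real. -/
theorem fock_conj (n : ℕ) (x : ℝ) : (starRingEnd ℂ) (fock n x) = fock n x := by
  have hc : ∀ f : 𝓢(ℝ, ℂ), (∀ x, (starRingEnd ℂ) (f x) = f x) →
      ∀ x, (starRingEnd ℂ) (creOp f x) = creOp f x := by
    intro f hf x
    have hd : (starRingEnd ℂ) (deriv f x) = deriv f x := by
      have h1 : HasDerivAt (fun y => (starRingEnd ℂ) (f y)) ((starRingEnd ℂ) (deriv f x)) x :=
        f.differentiableAt.hasDerivAt.star
      simp only [hf] at h1
      exact h1.deriv.symm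
    simp only [creOp, sub_apply, smul_apply,
      sub_apply, smul_apply, posOp_apply, momOp_apply, smul_eq_mul,
      map_mul, map_sub, map_inv₀, map_neg, Complex.conj_ofReal, Complex.conj_I, hf, hd]
    ring
  have h : ∀ n : ℕ, ∀ x, (starRingEnd ℂ) ((creOp^[n]) vacuum x) = (creOp^[n]) vacuum x := by
    intro n
    induction n with
    | zero => intro x; simp only [Function.iterate_zero, id, vacuum_apply, Complex.conj_ofReal]
    | succ n ih =>
      rw [Function.iterate_succ_apply']
      exact hc _ ih
  rw [fock, smul_apply, smul_eq_mul, map_mul, map_inv₀, Complex.conj_ofReal, h]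

/-- The `n`-th term of `e^{-β(n̂+1/2)} T = ∑ₙ e^{-β(n+1/2)} |n⟩⟨n|T⟩`; as the wave function
of `|n⟩` is real, `⟨n|T⟩` is the value of the distribution `T` at it. -/
def dampTerm (β : ℝ) (T : 𝓢'(ℝ, ℂ)) (n : ℕ) : H :=
  (((Real.exp (-β * (n + 1 / 2)) : ℝ) : ℂ) * T (fock n)) • ket (fock n)

/-- `e^{-β(n̂+1/2)}` applied to a generalized ket. -/
def damp (β : ℝ) (T : 𝓢'(ℝ, ℂ)) : H := ∑' n, dampTerm β T n

/-! ### The code states -/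

/-- The spacing `α_d = √(2π/d)` of the square lattice. -/
def spacing (d : ℕ) : ℝ := Real.sqrt (2 * Real.pi / d)

/-- The position `α_d (d s + j)` of the `s`-th peak. -/
def peak (d : ℕ) (j : Fin d) (s : ℤ) : ℝ := spacing d * (d * s + (j : ℕ))

/-- The ideal code state `√(α_d d) ∑ₛ |α_d (d s + j)⟩_q̂`, a Dirac comb. -/
def ideal (d : ℕ) (j : Fin d) : 𝓢'(ℝ, ℂ) :=
  ((Real.sqrt (spacing d * d) : ℝ) : ℂ) • ∑' s : ℤ, TemperedDistribution.delta (peak d j s)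

/-- The terms of Approximation 1:
`e^{-κ² α_d² (d s + j)²/2} X̂(α_d (d s + j)) Ŝ(-ln Δ) |0⟩_f`. -/
def approx1Term (d : ℕ) (j : Fin d) (κ Δ : ℝ) (s : ℤ) : H :=
  ((Real.exp (-(1 / 2) * κ ^ 2 * peak d j s ^ 2) : ℝ) : ℂ) •
    ket (dispX (peak d j s) (squeeze (-Real.log Δ) (fock 0)))

/-- The (unit) state `|j⁽¹⁾_{κ,Δ}⟩` of Approximation 1. -/
def approx1 (d : ℕ) (j : Fin d) (κ Δ : ℝ) : H :=
  NormedSpace.normalize (∑' s, approx1Term d j κ Δ s)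

/-- The integrand of Approximation 2, tested against the Schwartz function `f`:
`(2πγδ)⁻¹ e^{-r₁²/(2γ²) - r₂²/(2δ²)} V̂(r) |j_ideal⟩`. -/
def approx2Integrand (d : ℕ) (j : Fin d) (γ δ : ℝ) (f : 𝓢(ℝ, ℂ)) (r : ℝ × ℝ) : ℂ :=
  ((1 / (2 * Real.pi * γ * δ) *
      Real.exp (-(r.1 ^ 2 / (2 * γ ^ 2)) - r.2 ^ 2 / (2 * δ ^ 2)) : ℝ) : ℂ) *
    dispV r (ideal d j) f

/-- `ψ` is the (weak) integral `∬ dr₁ dr₂/(2πγδ) e^{-r₁²/(2γ²) - r₂²/(2δ²)} V̂(r) |j_ideal⟩`. -/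
def IsApprox2Integral (d : ℕ) (j : Fin d) (γ δ : ℝ) (ψ : H) : Prop :=
  ∀ f : 𝓢(ℝ, ℂ), Lp.toTemperedDistribution ψ f =
    ∫ r : ℝ × ℝ, approx2Integrand d j γ δ f r

open Classical in
/-- The integral of Approximation 2 before normalization (the zero vector if the weak integral
is not in the Hilbert space). -/
def approx2Integral (d : ℕ) (j : Fin d) (γ δ : ℝ) : H :=
  if h : ∃ ψ, IsApprox2Integral d j γ δ ψ then h.choose else 0

/-- The (unit) state `|j⁽²⁾_{γ,δ}⟩` of Approximation 2. -/
def approx2 (d : ℕ) (j : Fin d) (γ δ : ℝ) : H :=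
  NormedSpace.normalize (approx2Integral d j γ δ)

/-- The (unit) state `|j⁽³⁾_β⟩` of Approximation 3, proportional to
`e^{-β(n̂+1/2)} |j_ideal⟩`. -/
def approx3 (d : ℕ) (j : Fin d) (β : ℝ) : H :=
  NormedSpace.normalize (damp β (ideal d j))

/-- `λ(γ,δ) = 1 + γ²δ²/4`. -/
def lam (γ δ : ℝ) : ℝ := 1 + γ ^ 2 * δ ^ 2 / 4

end GKP

end

/-! All three states are positive multiples of one vector, `mehlerState`: the sum over the lattice
points y = `peak d j s` of K_β(·, y), where K_β is the Mehler kernel, the integral kernel of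
e^{-β(n̂+1/2)}. Normalization removes positive factors and the squeezing is a linear isometry, so
the theorem reduces to three computations on a single position ket at y.

Approximation 3: the Fock expansion of the damping operator applied to a position ket is the Hermite
bilinear series, summed in `hasSum_mehler`; absolute convergence over ℕ × ℤ allows the Fock sum and
the lattice sum to be exchanged (`hasSum_dampTerm`).

Approximation 1: since √(1 + κ²Δ²) = cosh β, squeezing turns the weighted displaced Gaussian at y
into a multiple of K_β(·, y), by completing the square (`squeeze_peakFn_apply`).

Approximation 2: the momentum-displacement integral is the Fourier transform of a Gaussian and
yields a Gaussian in (x + y)/2; the position displacement gives one in x - y. Their product is a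
multiple of K_β exactly because γ² = δ² = 2 tanh(β/2) (`exp_mul_exp_eq_mehler`,
`integral_weylTerm`), and dominated convergence moves the lattice sum through the integral.

The common vector is non-zero because K_β is strictly positive, as the pairing with the vacuum shows
(`mehlerState_ne_zero`). -/

namespace GKP

/-! ### Hermite-type sequences and their generating function -/

/-- The sequence with exponential generating function `exp (a z + b z² / 2)`. -/
def recSeq {R : Type*} [CommRing R] (a b : R) : ℕ → R
  | 0 => 1
  | 1 => a
  | n + 2 => a * recSeq a b (n + 1) + b * (n + 1) * recSeq a b n

/-- The recurrence is linear and its first step fixes `u 1` from `u 0`, so `u 0` is the only free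
parameter. This recognizes `recSeq` in derivatives of Gaussians and in powers of the creation
operator. -/
theorem eq_recSeq_mul {R : Type*} [CommRing R] {a b : R} {u : ℕ → R} (h1 : u 1 = a * u 0)
    (h : ∀ n : ℕ, u (n + 2) = a * u (n + 1) + b * (n + 1) * u n) (n : ℕ) :
    u n = recSeq a b n * u 0 := by
  induction n using Nat.twoStepInduction with
  | zero => simp [recSeq]
  | one => simp [recSeq, h1]
  | more n ih1 ih2 => rw [h, ih1, ih2, recSeq]; ring

theorem ofReal_recSeq (a b : ℝ) (n : ℕ) :
    ((recSeq a b n : ℝ) : ℂ) = recSeq (a : ℂ) (b : ℂ) n := by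
  induction n using Nat.twoStepInduction with
  | zero => simp [recSeq]
  | one => simp [recSeq]
  | more n ih1 ih2 => simp [recSeq, ih1, ih2]

/-- Taking absolute values in the recurrence gives a majorant sequence of the same type, whose
generating function is again explicit; it supplies the dominating function for Mehler's formula. -/
theorem abs_recSeq_le (a b : ℝ) (n : ℕ) : |recSeq a b n| ≤ recSeq |a| |b| n := by
  induction n using Nat.twoStepInduction with
  | zero => simp [recSeq]
  | one => simp [recSeq]
  | more n ih1 ih2 =>
    rw [recSeq, recSeq]
    refine (abs_add_le _ _).trans ?_
    rw [abs_mul, abs_mul, abs_mul, abs_of_nonneg (by positivity : (0 : ℝ) ≤ (n : ℝ) + 1)]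
    gcongr

/-- The exponential F satisfies F' = (a + bz)F. Differentiating this repeatedly gives the three-term
recurrence at the fixed point z: each derivative falling on a + bz contributes one more b, hence the
factor b(n + 1). -/
theorem iteratedDeriv_exp_quadratic (a b : ℂ) (n : ℕ) (z : ℂ) :
    iteratedDeriv n (fun z : ℂ => Complex.exp (a * z + b * z ^ 2 / 2)) z =
      recSeq (a + b * z) b n * Complex.exp (a * z + b * z ^ 2 / 2) := by
  set F : ℂ → ℂ := fun z : ℂ => Complex.exp (a * z + b * z ^ 2 / 2) with hF
  have hc : ContDiff ℂ ⊤ F := by fun_prop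
  have hd : ∀ n z, HasDerivAt (iteratedDeriv n F) (iteratedDeriv (n + 1) F z) z := fun n z => by
    rw [iteratedDeriv_succ]
    exact ((hc.differentiable_iteratedDeriv n (by simp)) z).hasDerivAt
  have hl : ∀ z : ℂ, HasDerivAt (fun z : ℂ => a + b * z) b z := fun z => by
    simpa using ((hasDerivAt_id z).const_mul b).const_add a
  have h1 : ∀ z, iteratedDeriv 1 F z = (a + b * z) * iteratedDeriv 0 F z := fun z => by
    have h := ((hasDerivAt_id z).const_mul a).add (((hasDerivAt_pow 2 z).const_mul b).div_const 2)
    rw [iteratedDeriv_one, iteratedDeriv_zero]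
    refine (h.cexp.congr_deriv ?_).deriv
    simp only [hF, id, Pi.add_apply]
    ring_nf
  have h2 : ∀ (n : ℕ) z, iteratedDeriv (n + 2) F z =
      (a + b * z) * iteratedDeriv (n + 1) F z + b * (n + 1) * iteratedDeriv n F z := by
    intro n
    induction n with
    | zero =>
      intro z
      have h := (hl z).mul (hd 0 z)
      have he : iteratedDeriv 1 F = (fun z => a + b * z) * iteratedDeriv 0 F := funext h1
      rw [← he] at h
      rw [(hd 1 z).unique h]
      push_cast
      ring
    | succ n ih =>
      intro z
      have h := ((hl z).mul (hd (n + 1) z)).add ((hd n z).const_mul (b * (n + 1)))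
      have he : iteratedDeriv (n + 2) F = (fun z => a + b * z) * iteratedDeriv (n + 1) F +
        fun z => b * (n + 1) * iteratedDeriv n F z := funext ih
      rw [← he] at h
      rw [(hd (n + 2) z).unique h]
      push_cast
      ring
  have := eq_recSeq_mul (u := fun n => iteratedDeriv n F z) (h1 z) (fun n => h2 n z) n
  simpa using this

theorem hasSum_recSeq (a b z : ℂ) :
    HasSum (fun n : ℕ => recSeq a b n * z ^ n / n.factorial)
      (Complex.exp (a * z + b * z ^ 2 / 2)) := by
  have hd : Differentiable ℂ (fun z : ℂ => Complex.exp (a * z + b * z ^ 2 / 2)) := by fun_prop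
  have h := Complex.hasSum_taylorSeries_of_entire hd 0 z
  have he : ∀ n : ℕ, recSeq a b n * z ^ n / n.factorial =
      (n.factorial : ℂ)⁻¹ • (z - 0) ^ n • iteratedDeriv n
        (fun z : ℂ => Complex.exp (a * z + b * z ^ 2 / 2)) 0 := fun n => by
    rw [iteratedDeriv_exp_quadratic]
    simp only [smul_eq_mul, mul_zero, add_zero, sub_zero, ne_eq, OfNat.ofNat_ne_zero,
      not_false_eq_true, zero_pow, zero_div, Complex.exp_zero, mul_one]
    ring
  simp only [he]
  exact h

theorem hasSum_recSeq_real (a b z : ℝ) :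
    HasSum (fun n : ℕ => recSeq a b n * z ^ n / n.factorial)
      (Real.exp (a * z + b * z ^ 2 / 2)) := by
  rw [← Complex.hasSum_ofReal]
  simpa [ofReal_recSeq] using hasSum_recSeq a b z

/-! ### Fock wave functions -/

theorem annOp_add_creOp (f : 𝓢(ℝ, ℂ)) (x : ℝ) :
    annOp f x + creOp f x = ((Real.sqrt 2 : ℝ) : ℂ) * x * f x := by
  have h2 : (((Real.sqrt 2 : ℝ) : ℂ)) ≠ 0 := by simp
  have h3 : ((Real.sqrt 2 : ℝ) : ℂ) * ((Real.sqrt 2 : ℝ) : ℂ) = 2 := by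
    rw [← Complex.ofReal_mul, Real.mul_self_sqrt (by norm_num)]; norm_num
  simp only [annOp, creOp, add_apply, sub_apply, smul_apply, smul_eq_mul, posOp_apply]
  field_simp
  linear_combination (-x * f x) * h3

theorem annOp_creOp_iterate (n : ℕ) :
    annOp (creOp^[n + 1] vacuum) = ((n : ℂ) + 1) • creOp^[n] vacuum := by
  induction n with
  | zero => simp [annOp_creOp, annOp_vacuum]
  | succ n ih =>
    rw [Function.iterate_succ_apply', annOp_creOp, ih, map_smul,
      ← Function.iterate_succ_apply' creOp, Nat.cast_succ, add_smul (_ + 1) (1 : ℂ), one_smul]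

/-- The recurrence comes from â + â† = √2 q̂ together with â(â†)ⁿ⁺¹|0⟩ = (n + 1)(â†)ⁿ|0⟩, read
pointwise at x; no derivative has to be computed. Here `recSeq a (-1) n` is the probabilists'
Hermite polynomial Heₙ(a). -/
theorem creOp_iterate_apply (n : ℕ) (x : ℝ) :
    (creOp^[n] vacuum) x = ((recSeq (Real.sqrt 2 * x) (-1) n : ℝ) : ℂ) * vacuum x := by
  rw [ofReal_recSeq]
  refine eq_recSeq_mul (u := fun n => (creOp^[n] vacuum) x) ?_ (fun n => ?_) n
  · have := annOp_add_creOp vacuum x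
    rw [annOp_vacuum] at this
    simpa using this
  · have := annOp_add_creOp (creOp^[n + 1] vacuum) x
    rw [annOp_creOp_iterate, ← Function.iterate_succ_apply' creOp, smul_apply, smul_eq_mul] at this
    push_cast
    linear_combination this

/-! ### Mehler's formula -/

theorem integral_gaussian_affine {s : ℝ} (hs : 0 < s) (c d : ℂ) :
    ∫ x : ℝ, Complex.exp (-s * x ^ 2 + c * x + d) =
      (Real.sqrt (Real.pi / s) : ℝ) * Complex.exp (d + c ^ 2 / (4 * s)) := by
  rw [integral_cexp_quadratic (by simpa using hs), neg_neg, Real.sqrt_eq_rpow,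
    Complex.ofReal_cpow (by positivity)]
  congr 2
  · push_cast; ring
  · push_cast; ring
  · ring

/-- Both sides are the n-th derivative of the Gaussian moment generating function e^{z²/2} at z =
iw. -/
theorem recSeq_eq_integral (w : ℝ) (n : ℕ) :
    ∫ t : ℝ, (t : ℂ) ^ n * Complex.exp (Complex.I * w * t)
        ∂(ProbabilityTheory.gaussianReal 0 1) =
      Complex.I ^ n * recSeq (w : ℂ) (-1) n * Complex.exp (-(w ^ 2 / 2)) := by
  have h := ProbabilityTheory.iteratedDeriv_complexMGF (X := id)
    (μ := ProbabilityTheory.gaussianReal 0 1) (z := Complex.I * w)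
    (by simp [ProbabilityTheory.integrableExpSet_id_gaussianReal]) n
  have he : ProbabilityTheory.complexMGF id (ProbabilityTheory.gaussianReal 0 1) =
      fun z => Complex.exp (0 * z + 1 * z ^ 2 / 2) := by
    funext z
    rw [ProbabilityTheory.complexMGF_id_gaussianReal]
    simp
  rw [he, iteratedDeriv_exp_quadratic] at h
  simp only [id] at h
  rw [← h]
  -- Rotating the argument by i changes b = 1 into b = -1 at the cost of iⁿ, because i² = -1 enters
  -- the recurrence.
  have h3 : recSeq (0 + 1 * (Complex.I * w)) 1 n = Complex.I ^ n * recSeq (w : ℂ) (-1) n := by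
    have := eq_recSeq_mul (a := Complex.I * w) (b := 1)
      (u := fun n => Complex.I ^ n * recSeq (w : ℂ) (-1) n) (by simp [recSeq]) (fun n => by
        simp only [recSeq]
        linear_combination (-Complex.I ^ n * (n + 1) * recSeq (w : ℂ) (-1) n) * Complex.I_sq) n
    rw [this]
    simp [recSeq]
  rw [h3]
  congr 2
  rw [mul_pow, Complex.I_sq]
  ring

theorem integrable_gaussianReal_iff {f : ℝ → ℝ} :
    Integrable f (ProbabilityTheory.gaussianReal 0 1) ↔
      Integrable fun t => ProbabilityTheory.gaussianPDFReal 0 1 t * f t := by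
  rw [ProbabilityTheory.gaussianReal_of_var_ne_zero _ one_ne_zero,
    integrable_withDensity_iff_integrable_smul' (ProbabilityTheory.measurable_gaussianPDF 0 1)
      (ae_of_all _ fun _ => ProbabilityTheory.gaussianPDF_lt_top)]
  simp [ProbabilityTheory.toReal_gaussianPDF]

theorem gaussianPDFReal_zero_one (t : ℝ) : ProbabilityTheory.gaussianPDFReal 0 1 t =
    (Real.sqrt (2 * Real.pi))⁻¹ * Real.exp (-t ^ 2 / 2) := by
  simp [ProbabilityTheory.gaussianPDFReal]

theorem integrable_exp_quadratic {s : ℝ} (hs : 0 < s) (c : ℝ) :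
    Integrable fun t : ℝ => Real.exp (-s * t ^ 2 + c * t) := by
  refine (integrable_cexp_quadratic (b := s) (by simpa using hs) c 0).norm.congr
    (ae_of_all _ fun t => ?_)
  simp only [add_zero]
  rw [Complex.norm_exp]
  congr 1
  norm_cast

/-- The density leaves the Gaussian rate (1 - r)/2 > 0, and e^{c|t|} is at most e^{ct} + e^{-ct}. -/
theorem integrable_exp_abs_gaussianReal {r : ℝ} (hr : r < 1) (c : ℝ) :
    Integrable (fun t => Real.exp (c * |t| + r * t ^ 2 / 2))
      (ProbabilityTheory.gaussianReal 0 1) := by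
  rw [integrable_gaussianReal_iff]
  have hs : 0 < (1 - r) / 2 := by linarith
  have h := ((integrable_exp_quadratic hs c).add (integrable_exp_quadratic hs (-c))).const_mul
    (Real.sqrt (2 * Real.pi))⁻¹
  refine h.mono' ?_ (ae_of_all _ fun t => ?_)
  · simp only [gaussianPDFReal_zero_one]
    fun_prop
  · rw [gaussianPDFReal_zero_one, Real.norm_of_nonneg (by positivity), mul_assoc, ← Real.exp_add,
      Pi.add_apply]
    gcongr
    rcases abs_cases t with ⟨h, -⟩ | ⟨h, -⟩ <;> rw [h]
    · refine le_trans (le_of_eq ?_) (le_add_of_nonneg_right (Real.exp_pos _).le)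
      congr 1; ring
    · refine le_trans (le_of_eq ?_) (le_add_of_nonneg_left (Real.exp_pos _).le)
      congr 1; ring

/-- The bilinear generating function of the Hermite polynomials. -/
theorem hasSum_recSeq_mul_recSeq {ρ : ℝ} (h0 : 0 < ρ) (h1 : ρ < 1) (a b : ℝ) :
    HasSum (fun n : ℕ => ρ ^ n * recSeq a (-1) n * recSeq b (-1) n / n.factorial)
      ((Real.sqrt (1 - ρ ^ 2))⁻¹ *
        Real.exp ((2 * ρ * a * b - ρ ^ 2 * (a ^ 2 + b ^ 2)) / (2 * (1 - ρ ^ 2)))) := by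
  have hρ : 0 < 1 - ρ ^ 2 := by nlinarith
  -- Heₙ(b) is replaced by its integral over the standard Gaussian, so that the n-sum under the
  -- integral is the generating function of Heₙ(a) at -iρt. The majorants sum to e^{|a|ρ|t| +
  -- ρ²t²/2}, integrable because ρ < 1.
  have key := hasSum_integral_of_dominated_convergence
    (μ := ProbabilityTheory.gaussianReal 0 1)
    (F := fun (n : ℕ) (t : ℝ) => recSeq (a : ℂ) (-1) n * (-Complex.I * ρ * t) ^ n / n.factorial *
      Complex.exp (Complex.I * b * t))
    (f := fun t : ℝ => Complex.exp (a * (-Complex.I * ρ * t) +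
      (-1) * (-Complex.I * ρ * t) ^ 2 / 2) * Complex.exp (Complex.I * b * t))
    (fun n t => recSeq |a| 1 n * (ρ * |t|) ^ n / n.factorial)
    (fun n => by fun_prop)
    (fun n => ae_of_all _ fun t => ?_)
    (ae_of_all _ fun t => (hasSum_recSeq_real |a| 1 (ρ * |t|)).summable)
    ?_
    (ae_of_all _ fun t => (hasSum_recSeq a (-1) (-Complex.I * ρ * t)).mul_right _)
  · have hF : ∀ n : ℕ, ∫ t : ℝ, recSeq (a : ℂ) (-1) n * (-Complex.I * ρ * t) ^ n / n.factorial *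
        Complex.exp (Complex.I * b * t) ∂(ProbabilityTheory.gaussianReal 0 1) =
        ((ρ ^ n * recSeq a (-1) n * recSeq b (-1) n / n.factorial : ℝ) : ℂ) *
          Complex.exp (-(b ^ 2 / 2)) := by
      intro n
      have : ∀ t : ℝ, recSeq (a : ℂ) (-1) n * (-Complex.I * ρ * t) ^ n / n.factorial *
        Complex.exp (Complex.I * b * t) = (recSeq (a : ℂ) (-1) n * (-Complex.I * ρ) ^ n /
          n.factorial) * (t ^ n * Complex.exp (Complex.I * b * t)) := fun t => by
        rw [mul_pow _ (t : ℂ)]; ring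
      simp only [this]
      rw [integral_const_mul, recSeq_eq_integral]
      have hI : (-Complex.I) ^ n * Complex.I ^ n = 1 := by rw [← mul_pow]; simp
      push_cast [ofReal_recSeq]
      rw [mul_pow]
      linear_combination (ρ ^ n * recSeq (a : ℂ) (-1) n * recSeq (b : ℂ) (-1) n / n.factorial *
        Complex.exp (-(b ^ 2 / 2))) * hI
    have hf : ∫ t : ℝ, Complex.exp (a * (-Complex.I * ρ * t) +
        (-1) * (-Complex.I * ρ * t) ^ 2 / 2) * Complex.exp (Complex.I * b * t)
          ∂(ProbabilityTheory.gaussianReal 0 1) =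
        (((Real.sqrt (1 - ρ ^ 2))⁻¹ * Real.exp ((2 * ρ * a * b - ρ ^ 2 * (a ^ 2 + b ^ 2)) /
          (2 * (1 - ρ ^ 2))) : ℝ) : ℂ) * Complex.exp (-(b ^ 2 / 2)) := by
      rw [ProbabilityTheory.integral_gaussianReal_eq_integral_smul one_ne_zero]
      have : ∀ t : ℝ, ProbabilityTheory.gaussianPDFReal 0 1 t • (Complex.exp
          (a * (-Complex.I * ρ * t) + (-1) * (-Complex.I * ρ * t) ^ 2 / 2) *
            Complex.exp (Complex.I * b * t)) = ((Real.sqrt (2 * Real.pi))⁻¹ : ℝ) *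
          Complex.exp (-((1 - ρ ^ 2) / 2 : ℝ) * t ^ 2 + (Complex.I * (b - ρ * a)) * t + 0) := by
        intro t
        rw [gaussianPDFReal_zero_one, Complex.real_smul, Complex.ofReal_mul, mul_assoc,
          Complex.ofReal_exp, ← Complex.exp_add, ← Complex.exp_add]
        congr 2
        push_cast
        linear_combination (-ρ ^ 2 * t ^ 2 / 2) * Complex.I_sq
      simp only [this]
      rw [integral_const_mul, integral_gaussian_affine (by linarith), Complex.ofReal_mul,
        ← mul_assoc, ← Complex.ofReal_mul, mul_assoc _ _ (Complex.exp _), Complex.ofReal_exp,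
        ← Complex.exp_add]
      congr 2
      · rw [show Real.pi / ((1 - ρ ^ 2) / 2) = (2 * Real.pi) / (1 - ρ ^ 2) by field_simp,
          Real.sqrt_div (by positivity)]
        have : Real.sqrt (2 * Real.pi) ≠ 0 := by positivity
        field_simp
      · have hc : (1 - (ρ : ℂ) ^ 2) ≠ 0 := by exact_mod_cast hρ.ne'
        push_cast
        rw [mul_pow, Complex.I_sq]
        field_simp
        ring
    simp only [hF, hf] at key
    have := (hasSum_mul_right_iff (Complex.exp_ne_zero _)).1 key
    exact Complex.hasSum_ofReal.1 this
  · have hn : ‖recSeq (a : ℂ) (-1) n‖ ≤ recSeq |a| 1 n := by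
      have := abs_recSeq_le a (-1) n
      rw [abs_neg, abs_one] at this
      rw [show (-1 : ℂ) = ((-1 : ℝ) : ℂ) by simp, ← ofReal_recSeq, Complex.norm_real]
      exact this
    have he : ‖Complex.exp (Complex.I * b * t)‖ = 1 := by
      rw [show Complex.I * b * t = ((b * t : ℝ) : ℂ) * Complex.I by push_cast; ring,
        Complex.norm_exp_ofReal_mul_I]
    rw [norm_mul, he, mul_one, norm_div, norm_mul, norm_pow, norm_mul, norm_mul, norm_neg,
      Complex.norm_I, one_mul, Complex.norm_real, Complex.norm_real, Complex.norm_natCast,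
      Real.norm_of_nonneg h0.le, Real.norm_eq_abs]
    gcongr
  · refine (integrable_exp_abs_gaussianReal (r := ρ ^ 2) (by linarith) (|a| * ρ)).congr
      (ae_of_all _ fun t => ?_)
    dsimp only
    rw [(hasSum_recSeq_real |a| 1 (ρ * |t|)).tsum_eq, mul_pow, sq_abs]
    congr 1
    ring

/-- The wave function of the Fock state `|n⟩_f` as a real function. -/
noncomputable def fockReal (n : ℕ) (x : ℝ) : ℝ :=
  recSeq (Real.sqrt 2 * x) (-1) n / Real.sqrt n.factorial *
    (Real.pi ^ (-(1 / 4) : ℝ) * Real.exp (-(x ^ 2 / 2)))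

theorem fock_apply (n : ℕ) (x : ℝ) : fock n x = (fockReal n x : ℂ) := by
  rw [fock, smul_apply, smul_eq_mul, creOp_iterate_apply, vacuum_apply, fockReal]
  push_cast
  ring

/-- The Mehler kernel, the position-space kernel of `e^{-β(n̂+1/2)}`. -/
noncomputable def mehler (β x y : ℝ) : ℝ :=
  (Real.sqrt (2 * Real.pi * Real.sinh β))⁻¹ *
    Real.exp (-(Real.cosh β * (x ^ 2 + y ^ 2) - 2 * x * y) / (2 * Real.sinh β))

/-- This is the bilinear series at ρ = e^{-β}, a = √2 x, b = √2 y. Since 1 - ρ² = 2e^{-β} sinh β,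
the zero-point factor e^{-β/2} cancels against √(1 - ρ²). -/
theorem hasSum_mehler {β : ℝ} (hβ : 0 < β) (x y : ℝ) :
    HasSum (fun n : ℕ => Real.exp (-β * (n + 1 / 2)) * fockReal n x * fockReal n y)
      (mehler β x y) := by
  have hs : 0 < Real.sinh β := Real.sinh_pos_iff.2 hβ
  have hρ1 : Real.exp (-β) < 1 := by simpa using hβ
  have h := (hasSum_recSeq_mul_recSeq (Real.exp_pos (-β)) hρ1 (Real.sqrt 2 * x)
    (Real.sqrt 2 * y)).mul_left (Real.exp (-β / 2) * (Real.sqrt Real.pi)⁻¹ *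
      Real.exp (-((x ^ 2 + y ^ 2) / 2)))
  have hpi : Real.pi ^ (-(1 / 4) : ℝ) * Real.pi ^ (-(1 / 4) : ℝ) = (Real.sqrt Real.pi)⁻¹ := by
    rw [← Real.rpow_add Real.pi_pos, Real.sqrt_eq_rpow, ← Real.rpow_neg Real.pi_pos.le]
    norm_num
  have h2 : Real.sqrt 2 ^ 2 = 2 := Real.sq_sqrt (by norm_num)
  have e1 : 1 - Real.exp (-β) ^ 2 = 2 * Real.exp (-β) * Real.sinh β := by
    rw [Real.sinh_eq]
    have : Real.exp (-β) * Real.exp β = 1 := by rw [← Real.exp_add]; simp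
    linear_combination -this
  have e3 : Real.exp (-β / 2) ^ 2 = Real.exp (-β) := by rw [← Real.exp_nat_mul]; ring_nf
  have hL : ∀ n : ℕ, Real.exp (-β * (n + 1 / 2)) * fockReal n x * fockReal n y =
      Real.exp (-β / 2) * (Real.sqrt Real.pi)⁻¹ * Real.exp (-((x ^ 2 + y ^ 2) / 2)) *
        (Real.exp (-β) ^ n * recSeq (Real.sqrt 2 * x) (-1) n * recSeq (Real.sqrt 2 * y) (-1) n /
          n.factorial) := by
    intro n
    have hf : (Real.sqrt n.factorial)⁻¹ * (Real.sqrt n.factorial)⁻¹ = (n.factorial : ℝ)⁻¹ := by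
      rw [← mul_inv, Real.mul_self_sqrt (by positivity)]
    have hx : Real.exp (-β * (n + 1 / 2)) = Real.exp (-β / 2) * Real.exp (-β) ^ n := by
      rw [← Real.exp_nat_mul, ← Real.exp_add]; ring_nf
    have hy : Real.exp (-((x ^ 2 + y ^ 2) / 2)) =
        Real.exp (-(x ^ 2 / 2)) * Real.exp (-(y ^ 2 / 2)) := by
      rw [← Real.exp_add]; ring_nf
    rw [fockReal, fockReal, hx, hy, ← hpi]
    simp only [div_eq_mul_inv]
    rw [← hf]
    ring
  have hR : mehler β x y =
      Real.exp (-β / 2) * (Real.sqrt Real.pi)⁻¹ * Real.exp (-((x ^ 2 + y ^ 2) / 2)) *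
        ((Real.sqrt (1 - Real.exp (-β) ^ 2))⁻¹ *
          Real.exp ((2 * Real.exp (-β) * (Real.sqrt 2 * x) * (Real.sqrt 2 * y) -
            Real.exp (-β) ^ 2 * ((Real.sqrt 2 * x) ^ 2 + (Real.sqrt 2 * y) ^ 2)) /
              (2 * (1 - Real.exp (-β) ^ 2)))) := by
    rw [mehler]
    have hsq : Real.exp (-β / 2) * (Real.sqrt Real.pi)⁻¹ * (Real.sqrt (1 - Real.exp (-β) ^ 2))⁻¹ =
        (Real.sqrt (2 * Real.pi * Real.sinh β))⁻¹ := by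
      rw [e1, show 2 * Real.exp (-β) * Real.sinh β = Real.exp (-β / 2) ^ 2 * (2 * Real.sinh β) by
          rw [e3]; ring,
        Real.sqrt_mul (by positivity), Real.sqrt_sq (Real.exp_pos _).le,
        show 2 * Real.pi * Real.sinh β = Real.pi * (2 * Real.sinh β) by ring,
        Real.sqrt_mul Real.pi_pos.le]
      have := Real.exp_pos (-β / 2)
      field_simp
    rw [← hsq, mul_mul_mul_comm, ← Real.exp_add]
    congr 2
    have hE := Real.exp_pos (-β)
    have hc : Real.cosh β = Real.sinh β + Real.exp (-β) := by rw [← Real.cosh_sub_sinh]; ring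
    rw [e1, mul_pow, mul_pow, h2, hc,
      show 2 * Real.exp (-β) * (Real.sqrt 2 * x) * (Real.sqrt 2 * y) =
        2 * Real.exp (-β) * x * y * Real.sqrt 2 ^ 2 by ring, h2]
    field_simp
    ring
  simp only [hL]
  rw [hR]
  exact h

/-! ### Bounds for Fock states -/

/-- On the diagonal x = y, Mehler's series at inverse temperature 2ε has non-negative terms, so each
one is at most K_{2ε}(x, x), a Gaussian in x. Square roots give `B` and τ. -/
theorem abs_fockReal_le {ε : ℝ} (hε : 0 < ε) : ∃ B τ : ℝ, 0 < B ∧ 0 < τ ∧ ∀ n x,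
    |fockReal n x| ≤ B * Real.exp (ε * n) * Real.exp (-τ * x ^ 2) := by
  have hs : 0 < Real.sinh (2 * ε) := Real.sinh_pos_iff.2 (by linarith)
  have hc : 1 < Real.cosh (2 * ε) := Real.one_lt_cosh.2 (by linarith)
  set A := Real.exp ε * (Real.sqrt (2 * Real.pi * Real.sinh (2 * ε)))⁻¹ with hA
  refine ⟨Real.sqrt A, (Real.cosh (2 * ε) - 1) / (2 * Real.sinh (2 * ε)), by positivity,
    div_pos (by linarith) (by linarith), fun n x => ?_⟩
  have h := hasSum_mehler (β := 2 * ε) (by linarith) x x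
  have h1 := le_hasSum h n fun m _ => by
    rw [mul_assoc]; exact mul_nonneg (Real.exp_pos _).le (mul_self_nonneg _)
  rw [← abs_of_nonneg (by positivity : 0 ≤ Real.sqrt A * Real.exp (ε * n) * Real.exp
    (-((Real.cosh (2 * ε) - 1) / (2 * Real.sinh (2 * ε))) * x ^ 2)), ← sq_le_sq, mul_pow, mul_pow,
    Real.sq_sqrt (by positivity), ← Real.exp_nat_mul, ← Real.exp_nat_mul]
  have h2 : fockReal n x ^ 2 = Real.exp (2 * ε * (n + 1 / 2)) *
      (Real.exp (-(2 * ε) * (n + 1 / 2)) * fockReal n x * fockReal n x) := by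
    rw [← mul_assoc, ← mul_assoc, ← Real.exp_add]
    ring_nf
    simp
  rw [h2]
  refine (mul_le_mul_of_nonneg_left h1 (Real.exp_pos _).le).trans (le_of_eq ?_)
  rw [mehler, hA, show 2 * ε * ((n : ℝ) + 1 / 2) = ε + 2 * (ε * n) by ring, Real.exp_add]
  have : -(Real.cosh (2 * ε) * (x ^ 2 + x ^ 2) - 2 * x * x) / (2 * Real.sinh (2 * ε)) =
      (2 : ℕ) * (-((Real.cosh (2 * ε) - 1) / (2 * Real.sinh (2 * ε))) * x ^ 2) := by
    field_simp
    push_cast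
    ring
  rw [this]
  push_cast
  ring

theorem memLp_gaussian {τ : ℝ} (hτ : 0 < τ) :
    MemLp (fun x : ℝ => ((Real.exp (-τ * x ^ 2) : ℝ) : ℂ)) 2 volume := by
  rw [memLp_two_iff_integrable_sq_norm (by fun_prop)]
  refine (integrable_exp_quadratic (s := 2 * τ) (by linarith) 0).congr (ae_of_all _ fun x => ?_)
  simp only [Complex.norm_real, Real.norm_eq_abs, Real.abs_exp]
  rw [← Real.exp_nat_mul]
  congr 1
  push_cast
  ring

/-- An arbitrarily slow exponential bound suffices against the damping e^{-βn}, so the Fock states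
need not be shown to be normalized. -/
theorem norm_ket_fock_le {ε : ℝ} (hε : 0 < ε) : ∃ B : ℝ, 0 < B ∧ ∀ n,
    ‖ket (fock n)‖ ≤ B * Real.exp (ε * n) := by
  obtain ⟨B, τ, hB, hτ, h⟩ := abs_fockReal_le hε
  refine ⟨B * (‖(memLp_gaussian hτ).toLp‖ + 1), by positivity, fun n => ?_⟩
  have h1 : ‖ket (fock n)‖ ≤ B * Real.exp (ε * n) * ‖(memLp_gaussian hτ).toLp‖ := by
    refine Lp.norm_le_mul_norm_of_ae_le_mul ?_
    filter_upwards [SchwartzMap.coeFn_toLp (fock n) 2 volume, (memLp_gaussian hτ).coeFn_toLp]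
      with x hx hy
    rw [ket, hx, hy, fock_apply, Complex.norm_real, Complex.norm_real, Real.norm_eq_abs,
      Real.norm_eq_abs, Real.abs_exp]
    exact h n x
  refine h1.trans ?_
  have := (Real.exp_pos (ε * n)).le
  have : 0 ≤ B * Real.exp (ε * n) := by positivity
  nlinarith

/-! ### The lattice and the ideal state -/

theorem spacing_pos {d : ℕ} (j : Fin d) : 0 < spacing d := by
  have : (0 : ℝ) < d := by exact_mod_cast j.pos
  rw [spacing]
  positivity

theorem summable_peak {d : ℕ} (j : Fin d) : Summable fun s : ℤ => ((1 + |peak d j s|) ^ 2)⁻¹ := by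
  have hd : (0 : ℝ) < d := by exact_mod_cast j.pos
  have ha := mul_pos (spacing_pos j) hd
  set a := spacing d * d
  set b := spacing d * (j : ℕ)
  have hp : ∀ s, peak d j s = a * s + b := fun s => by simp only [peak, a, b]; ring
  have h1 : Summable fun s : ℤ => ((1 + |b|) / a + 1) ^ 2 * |(s : ℝ)| ^ (-2 : ℝ) :=
    (Real.summable_abs_int_rpow (by norm_num)).mul_left _
  refine Summable.of_norm_bounded_eventually h1 ?_
  -- At s = 0 the comparison term takes the value 0, so that index has to be excluded.
  filter_upwards [(Set.finite_singleton (0 : ℤ)).compl_mem_cofinite] with s hs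
  have hs : 0 < |(s : ℝ)| := by simpa using hs
  rw [Real.norm_of_nonneg (by positivity), Real.rpow_neg hs.le, Real.rpow_two, ← inv_inv
    (((1 + |b|) / a + 1) ^ 2), ← mul_inv]
  apply inv_anti₀ (by positivity)
  rw [← div_eq_inv_mul, div_le_iff₀ (by positivity), ← mul_pow]
  gcongr
  have h2 : a * |(s : ℝ)| ≤ |peak d j s| + |b| := by
    rw [← abs_of_pos ha, ← abs_mul, hp]
    calc |a * (s : ℝ)| = |(a * s + b) - b| := by ring_nf
      _ ≤ _ := abs_sub _ _
  have h3 : |(s : ℝ)| ≤ (|peak d j s| + |b|) / a := by rw [le_div_iff₀ ha]; linarith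
  have h4 : (|peak d j s| + |b|) / a ≤ (1 + |peak d j s|) * ((1 + |b|) / a) := by
    rw [← mul_div_assoc]
    gcongr
    nlinarith [abs_nonneg b, abs_nonneg (peak d j s),
      mul_nonneg (abs_nonneg b) (abs_nonneg (peak d j s))]
  nlinarith [abs_nonneg (peak d j s)]

theorem one_add_abs_sq_le {τ : ℝ} (hτ : 0 < τ) (y : ℝ) :
    (1 + |y|) ^ 2 ≤ 2 * (1 + τ⁻¹) * Real.exp (τ * y ^ 2) := by
  have h1 : (1 + |y|) ^ 2 ≤ 2 * (1 + y ^ 2) := by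
    nlinarith [sq_nonneg (1 - |y|), sq_abs y]
  have h2 : 1 + y ^ 2 ≤ (1 + τ⁻¹) * (1 + τ * y ^ 2) := by
    have : (1 + τ⁻¹) * (1 + τ * y ^ 2) = 1 + y ^ 2 + τ⁻¹ + τ * y ^ 2 := by field_simp; ring
    rw [this]
    have : 0 ≤ τ⁻¹ + τ * y ^ 2 := by positivity
    linarith
  have h3 : (1 + τ⁻¹) * (1 + τ * y ^ 2) ≤ (1 + τ⁻¹) * Real.exp (τ * y ^ 2) :=
    mul_le_mul_of_nonneg_left (by linarith [Real.add_one_le_exp (τ * y ^ 2)]) (by positivity)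
  linarith

theorem summable_exp_peak {d : ℕ} (j : Fin d) {τ : ℝ} (hτ : 0 < τ) :
    Summable fun s : ℤ => Real.exp (-τ * peak d j s ^ 2) := by
  refine Summable.of_nonneg_of_le (fun s => (Real.exp_pos _).le) (fun s => ?_)
    ((summable_peak j).mul_left (2 * (1 + τ⁻¹)))
  rw [← div_eq_mul_inv, le_div_iff₀ (by positivity), neg_mul, Real.exp_neg, inv_mul_le_iff₀
    (Real.exp_pos _), mul_comm]
  exact one_add_abs_sq_le hτ _

theorem norm_le_seminorm_div (f : 𝓢(ℝ, ℂ)) (x : ℝ) :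
    ‖f x‖ ≤ 2 ^ 2 * (Finset.Iic (2, 0)).sup (schwartzSeminormFamily ℂ ℝ ℂ) f *
      ((1 + |x|) ^ 2)⁻¹ := by
  have h := SchwartzMap.one_add_le_sup_seminorm_apply (𝕜 := ℂ) (m := (2, 0)) (k := 2) (n := 0)
    le_rfl le_rfl f x
  rw [norm_iteratedFDeriv_zero] at h
  rw [← div_eq_mul_inv, le_div_iff₀ (by positivity), mul_comm]
  exact h

theorem exists_decay (f : 𝓢(ℝ, ℂ)) : ∃ C : ℝ, 0 ≤ C ∧ ∀ x, ‖f x‖ ≤ C * ((1 + |x|) ^ 2)⁻¹ :=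
  ⟨_, by positivity, norm_le_seminorm_div f⟩

theorem summable_apply_peak {d : ℕ} (j : Fin d) (f : 𝓢(ℝ, ℂ)) :
    Summable fun s : ℤ => f (peak d j s) :=
  Summable.of_norm_bounded ((summable_peak j).mul_left _) fun _ => norm_le_seminorm_div f _

/-- The Dirac comb as a tempered distribution. -/
noncomputable def comb {d : ℕ} (j : Fin d) : 𝓢'(ℝ, ℂ) :=
  ContinuousLinearMap.toPointwiseConvergenceCLM _ _ _ _ <|
    SchwartzMap.mkCLMtoNormedSpace (𝕜 := ℂ) (σ := RingHom.id ℂ)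
      (fun f : 𝓢(ℝ, ℂ) => ∑' s : ℤ, f (peak d j s))
      (fun f g => by
        simpa using (summable_apply_peak j f).tsum_add (summable_apply_peak j g))
      (fun a f => by simp [tsum_mul_left])
      ⟨Finset.Iic (2, 0), 2 ^ 2 * ∑' s : ℤ, ((1 + |peak d j s|) ^ 2)⁻¹,
        mul_nonneg (by norm_num) (tsum_nonneg fun s => by positivity), fun f => by
        have h := tsum_of_norm_bounded ((summable_peak j).mul_left (2 ^ 2 *
          (Finset.Iic (2, 0)).sup (schwartzSeminormFamily ℂ ℝ ℂ) f)).hasSum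
            fun _ => norm_le_seminorm_div f _
        rw [tsum_mul_left] at h
        linarith⟩

theorem hasSum_delta_peak {d : ℕ} (j : Fin d) :
    HasSum (fun s : ℤ => (TemperedDistribution.delta (peak d j s) : 𝓢'(ℝ, ℂ))) (comb j) := by
  rw [HasSum, PointwiseConvergenceCLM.tendsto_iff_forall_tendsto]
  intro f
  have h := (summable_apply_peak j f).hasSum
  rw [HasSum] at h
  refine h.congr fun S => ?_
  simp

theorem hasSum_ideal {d : ℕ} (j : Fin d) (f : 𝓢(ℝ, ℂ)) :
    HasSum (fun s : ℤ => ((Real.sqrt (spacing d * d) : ℝ) : ℂ) * f (peak d j s))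
      (ideal d j f) := by
  rw [ideal, (hasSum_delta_peak j).tsum_eq]
  exact (summable_apply_peak j f).hasSum.mul_left _

/-! ### The embeddings into the Hilbert space and into tempered distributions -/

theorem ket_smul (c : ℂ) (f : 𝓢(ℝ, ℂ)) : ket (c • f) = c • ket f :=
  map_smul (SchwartzMap.toLpCLM ℂ ℂ 2 (volume : Measure ℝ)) c f

theorem toTemperedDistribution_ket (f g : 𝓢(ℝ, ℂ)) :
    Lp.toTemperedDistribution (ket f) g = ∫ x, g x * f x := by
  rw [Lp.toTemperedDistribution_apply]
  refine integral_congr_ae ?_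
  filter_upwards [SchwartzMap.coeFn_toLp f 2 volume] with x hx
  rw [ket, hx, smul_eq_mul]

theorem hasSum_toTemperedDistribution {ι : Type*} {u : ι → H} {v : H} (h : HasSum u v)
    (f : 𝓢(ℝ, ℂ)) :
    HasSum (fun i => Lp.toTemperedDistribution (u i) f) (Lp.toTemperedDistribution v f) :=
  (h.mapL (Lp.toTemperedDistributionCLM ℂ volume 2)).mapL
    (PointwiseConvergenceCLM.evalCLM (RingHom.id ℂ) ℂ f)

theorem toTemperedDistribution_injective {u v : H}
    (h : ∀ f : 𝓢(ℝ, ℂ), Lp.toTemperedDistribution u f = Lp.toTemperedDistribution v f) :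
    u = v := by
  have hk := Lp.ker_toTemperedDistributionCLM_eq_bot (F := ℂ) (μ := (volume : Measure ℝ)) (p := 2)
  refine LinearMap.ker_eq_bot.1 hk ?_
  ext f
  exact h f

theorem norm_ket_dispX (r : ℝ) (f : 𝓢(ℝ, ℂ)) : ‖ket (dispX r f)‖ = ‖ket f‖ := by
  have h : (dispX r f : ℝ → ℂ) = f ∘ fun x => x - r := funext (dispX_apply r f)
  have h2 := eLpNorm_comp_measurePreserving (p := 2) (f.continuous.aestronglyMeasurable)
    (measurePreserving_sub_right (volume : Measure ℝ) r)
  rw [ket, ket, SchwartzMap.toLp, SchwartzMap.toLp, Lp.norm_toLp, Lp.norm_toLp, h, h2]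

theorem coeFn_squeezeH (ξ : ℝ) (ψ : H) : squeezeH ξ ψ =ᵐ[volume]
    fun x : ℝ => ((Real.exp (ξ / 2) : ℝ) : ℂ) * ψ (Real.exp ξ * x) :=
  (memLp_squeeze ξ ψ).coeFn_toLp

theorem quasiMeasurePreserving_exp_mul (ξ : ℝ) :
    Measure.QuasiMeasurePreserving (fun x : ℝ => Real.exp ξ * x) volume volume :=
  ⟨by fun_prop, by
    rw [Real.map_volume_mul_left (Real.exp_ne_zero ξ)]
    exact Measure.smul_absolutelyContinuous⟩

/-- The squeezing operator as a linear isometry. -/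
noncomputable def squeezeIsometry (ξ : ℝ) : H →ₗᵢ[ℂ] H where
  toFun := squeezeH ξ
  map_add' φ ψ := by
    refine Lp.ext ?_
    filter_upwards [coeFn_squeezeH ξ (φ + ψ), Lp.coeFn_add (squeezeH ξ φ) (squeezeH ξ ψ),
      coeFn_squeezeH ξ φ, coeFn_squeezeH ξ ψ,
      (quasiMeasurePreserving_exp_mul ξ).ae_eq_comp (Lp.coeFn_add φ ψ)] with x h1 h2 h3 h4 h5
    simp only [Function.comp_apply, Pi.add_apply] at h2 h5
    rw [h1, h2, h3, h4, h5, mul_add]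
  map_smul' c ψ := by
    refine Lp.ext ?_
    filter_upwards [coeFn_squeezeH ξ (c • ψ), Lp.coeFn_smul c (squeezeH ξ ψ), coeFn_squeezeH ξ ψ,
      (quasiMeasurePreserving_exp_mul ξ).ae_eq_comp (Lp.coeFn_smul c ψ)] with x h1 h2 h3 h4
    simp only [Function.comp_apply, Pi.smul_apply, smul_eq_mul] at h2 h4
    rw [h1, RingHom.id_apply, h2, h3, h4]
    ring
  norm_map' := norm_squeezeH ξ

theorem squeezeH_normalize (ξ : ℝ) (ψ : H) :
    squeezeH ξ (NormedSpace.normalize ψ) = NormedSpace.normalize (squeezeH ξ ψ) := by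
  rw [NormedSpace.normalize, NormedSpace.normalize, norm_squeezeH]
  exact LinearMap.map_smul_of_tower (squeezeIsometry ξ).toLinearMap ‖ψ‖⁻¹ ψ

/-! ### The terms of Approximation 1 and the Mehler kernel -/

/-- The terms of Approximation 1 as Schwartz functions, before squeezing. -/
noncomputable def peakFn (κ Δ y : ℝ) : 𝓢(ℝ, ℂ) :=
  ((Real.exp (-(1 / 2) * κ ^ 2 * y ^ 2) : ℝ) : ℂ) • dispX y (squeeze (-Real.log Δ) (fock 0))

theorem approx1Term_eq_ket (d : ℕ) (j : Fin d) (κ Δ : ℝ) (s : ℤ) :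
    approx1Term d j κ Δ s = ket (peakFn κ Δ (peak d j s)) := by
  rw [approx1Term, peakFn, ket_smul]

theorem summable_approx1Term {d : ℕ} (j : Fin d) {κ : ℝ} (hκ : 0 < κ) (Δ : ℝ) :
    Summable (approx1Term d j κ Δ) := by
  refine Summable.of_norm_bounded
    ((summable_exp_peak j (τ := 1 / 2 * κ ^ 2) (by positivity)).mul_right
      ‖ket (squeeze (-Real.log Δ) (fock 0))‖) fun s => le_of_eq ?_
  rw [approx1Term, norm_smul, norm_ket_dispX, Complex.norm_real, Real.norm_eq_abs, Real.abs_exp]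
  congr 2
  ring

/-- The proportionality constant between the squeezed terms of Approximation 1 and the Mehler
kernel. -/
noncomputable def peakConst (β Δ : ℝ) : ℝ :=
  Real.exp (Real.log (Real.cosh β) / 2) * Real.exp (-Real.log Δ / 2) *
    Real.pi ^ (-(1 / 4) : ℝ) * Real.sqrt (2 * Real.pi * Real.sinh β)

theorem peakConst_pos {β : ℝ} (hβ : 0 < β) (Δ : ℝ) : 0 < peakConst β Δ := by
  have := Real.sinh_pos_iff.2 hβ
  unfold peakConst
  positivity

/-- The exponent is -κ²y²/2 - (x cosh β - y)²/(2Δ²). The prescribed values give cosh²β/Δ² = κ² +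
1/Δ² = coth β and a cross term xy/sinh β, which is the Mehler exponent. -/
theorem squeeze_peakFn_apply {κ Δ β : ℝ} (hΔ : 0 < Δ) (hβ : 0 < β) (hκ2 : κ ^ 2 = Real.tanh β)
    (hΔ2 : Δ ^ 2 = Real.sinh β * Real.cosh β) (x y : ℝ) :
    squeeze (Real.log (Real.cosh β)) (peakFn κ Δ y) x =
      ((peakConst β Δ * mehler β x y : ℝ) : ℂ) := by
  have hs := Real.sinh_pos_iff.2 hβ
  have hc := Real.cosh_pos β
  have h0 : fock 0 = vacuum := by simp [fock]
  rw [squeeze_apply, peakFn, smul_apply, dispX_apply, squeeze_apply, h0, vacuum_apply,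
    Real.exp_log hc, Real.exp_neg (Real.log Δ), Real.exp_log hΔ, smul_eq_mul, peakConst, mehler]
  norm_cast
  have he : Real.exp (-(1 / 2) * κ ^ 2 * y ^ 2) *
      Real.exp (-((Δ⁻¹ * (Real.cosh β * x - y)) ^ 2 / 2)) =
      Real.exp (-(Real.cosh β * (x ^ 2 + y ^ 2) - 2 * x * y) / (2 * Real.sinh β)) := by
    rw [← Real.exp_add, mul_pow, inv_pow, hκ2, hΔ2, Real.tanh_eq_sinh_div_cosh]
    congr 1
    field_simp
    linear_combination y ^ 2 * Real.cosh_sq β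
  have : Real.sqrt (2 * Real.pi * Real.sinh β) ≠ 0 := by positivity
  rw [← he]
  field_simp

theorem one_add_tanh_mul {β : ℝ} :
    Real.sqrt (1 + Real.tanh β * (Real.sinh β * Real.cosh β)) = Real.cosh β := by
  have hc := Real.cosh_pos β
  rw [Real.tanh_eq_sinh_div_cosh, show 1 + Real.sinh β / Real.cosh β *
    (Real.sinh β * Real.cosh β) = Real.sinh β ^ 2 + 1 by field_simp; ring, ← Real.cosh_sq,
    Real.sqrt_sq hc.le]

/-- The function `x ↦ mehler β x y` as a Schwartz function (for `β > 0`). -/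
noncomputable def mehlerFn (β y : ℝ) : 𝓢(ℝ, ℂ) :=
  -- The Schwartz property is inherited from a squeezed peak of Approximation 1, taken at the
  -- parameters for which it is a multiple of the kernel.
  (((peakConst β (Real.sqrt (Real.sinh β * Real.cosh β)))⁻¹ : ℝ) : ℂ) •
    squeeze (Real.log (Real.cosh β))
      (peakFn (Real.sqrt (Real.tanh β)) (Real.sqrt (Real.sinh β * Real.cosh β)) y)

theorem mehlerFn_apply {β : ℝ} (hβ : 0 < β) (x y : ℝ) : mehlerFn β y x = (mehler β x y : ℂ) := by
  have hs := Real.sinh_pos_iff.2 hβ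
  have hc := Real.cosh_pos β
  have := peakConst_pos hβ (Real.sqrt (Real.sinh β * Real.cosh β))
  have ht : 0 < Real.tanh β := by rw [Real.tanh_eq_sinh_div_cosh]; positivity
  rw [mehlerFn, smul_apply, squeeze_peakFn_apply (by positivity) hβ (Real.sq_sqrt ht.le)
    (Real.sq_sqrt (by positivity)), smul_eq_mul, ← Complex.ofReal_mul,
    inv_mul_cancel_left₀ this.ne']

/-- The unnormalized code state `∑ₛ K_β(·, α_d (d s + j))`, with `K_β` the Mehler kernel. -/
noncomputable def mehlerState (d : ℕ) (j : Fin d) (β : ℝ) : H :=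
  ∑' s : ℤ, ket (mehlerFn β (peak d j s))

theorem squeezeH_approx1Term {κ Δ β : ℝ} (hΔ : 0 < Δ) (hβ : 0 < β)
    (hκ2 : κ ^ 2 = Real.tanh β) (hΔ2 : Δ ^ 2 = Real.sinh β * Real.cosh β) (d : ℕ) (j : Fin d)
    (s : ℤ) : squeezeH (Real.log (Real.cosh β)) (approx1Term d j κ Δ s) =
      (peakConst β Δ : ℂ) • ket (mehlerFn β (peak d j s)) := by
  rw [approx1Term_eq_ket, squeezeH_ket, ← ket_smul]
  congr 1
  ext x
  rw [squeeze_peakFn_apply hΔ hβ hκ2 hΔ2, smul_apply, mehlerFn_apply hβ, smul_eq_mul,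
    Complex.ofReal_mul]

/-- Convergence is transported from Approximation 1: the kernels are, up to one constant, the images
of its summable terms under the squeezing isometry. -/
theorem hasSum_mehlerState {β : ℝ} (hβ : 0 < β) {d : ℕ} (j : Fin d) :
    HasSum (fun s : ℤ => ket (mehlerFn β (peak d j s))) (mehlerState d j β) := by
  have hs := Real.sinh_pos_iff.2 hβ
  have hc := Real.cosh_pos β
  have ht : 0 < Real.tanh β := by rw [Real.tanh_eq_sinh_div_cosh]; positivity
  refine Summable.hasSum ?_
  have h := (summable_approx1Term j (Real.sqrt_pos.2 ht)
    (Real.sqrt (Real.sinh β * Real.cosh β))).mapL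
      (squeezeIsometry (Real.log (Real.cosh β))).toContinuousLinearMap
  have h2 : ∀ s, (squeezeIsometry (Real.log (Real.cosh β))).toContinuousLinearMap
      (approx1Term d j (Real.sqrt (Real.tanh β)) (Real.sqrt (Real.sinh β * Real.cosh β)) s) =
      (peakConst β (Real.sqrt (Real.sinh β * Real.cosh β)) : ℂ) •
        ket (mehlerFn β (peak d j s)) := fun s =>
    squeezeH_approx1Term (by positivity) hβ (Real.sq_sqrt ht.le)
      (Real.sq_sqrt (by positivity)) d j s
  simp only [h2] at h
  have hA := Complex.ofReal_ne_zero.2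
    (peakConst_pos hβ (Real.sqrt (Real.sinh β * Real.cosh β))).ne'
  refine (h.const_smul
    (peakConst β (Real.sqrt (Real.sinh β * Real.cosh β)) : ℂ)⁻¹).congr fun s => ?_
  rw [inv_smul_smul₀ hA]

theorem squeezeH_approx1 {κ Δ β : ℝ} (hκ : 0 < κ) (hΔ : 0 < Δ) (hβ : 0 < β)
    (hκ2 : κ ^ 2 = Real.tanh β) (hΔ2 : Δ ^ 2 = Real.sinh β * Real.cosh β) {d : ℕ} (j : Fin d) :
    squeezeH (Real.log (Real.sqrt (1 + κ ^ 2 * Δ ^ 2))) (approx1 d j κ Δ) =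
      NormedSpace.normalize (mehlerState d j β) := by
  rw [hκ2, hΔ2, one_add_tanh_mul, approx1, squeezeH_normalize]
  have h := ((summable_approx1Term j hκ Δ).hasSum.mapL
      (squeezeIsometry (Real.log (Real.cosh β))).toContinuousLinearMap)
  have h2 : ∀ s, (squeezeIsometry (Real.log (Real.cosh β))).toContinuousLinearMap
      (approx1Term d j κ Δ s) = (peakConst β Δ : ℂ) • ket (mehlerFn β (peak d j s)) := fun s =>
    squeezeH_approx1Term hΔ hβ hκ2 hΔ2 d j s
  simp only [h2] at h
  have h3 : squeezeH (Real.log (Real.cosh β)) (∑' s, approx1Term d j κ Δ s) =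
      peakConst β Δ • mehlerState d j β :=
    h.unique ((hasSum_mehlerState hβ j).const_smul (peakConst β Δ : ℂ))
  rw [h3, NormedSpace.normalize_smul_of_pos (peakConst_pos hβ Δ)]

theorem mehler_pos {β : ℝ} (hβ : 0 < β) (x y : ℝ) : 0 < mehler β x y := by
  have := Real.sinh_pos_iff.2 hβ
  unfold mehler
  positivity

/-- Pairing with the strictly positive vacuum turns the lattice sum into a series of strictly
positive numbers, which cannot sum to zero. -/
theorem mehlerState_ne_zero {β : ℝ} (hβ : 0 < β) {d : ℕ} (j : Fin d) : mehlerState d j β ≠ 0 := by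
  intro h0
  have h := hasSum_toTemperedDistribution (hasSum_mehlerState hβ j) vacuum
  set v : ℝ → ℝ := fun x => Real.pi ^ (-(1 / 4) : ℝ) * Real.exp (-(x ^ 2 / 2)) with hv
  have h1 : ∀ y : ℝ, Lp.toTemperedDistribution (ket (mehlerFn β y)) vacuum =
      ((∫ x, v x * mehler β x y : ℝ) : ℂ) := fun y => by
    rw [toTemperedDistribution_ket, ← integral_complex_ofReal]
    simp only [vacuum_apply, mehlerFn_apply hβ, hv, Complex.ofReal_mul]
  have h2 : ∀ y : ℝ, 0 < ∫ x, v x * mehler β x y := fun y => by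
    have hpos : ∀ x, 0 < v x * mehler β x y := fun x => mul_pos (by positivity) (mehler_pos hβ x y)
    have hint : Integrable fun x => v x * mehler β x y := by
      have := ((vacuum.memLp 2 volume).integrable_mul ((mehlerFn β y).memLp 2 volume)).re
      refine this.congr (ae_of_all _ fun x => ?_)
      simp only [Pi.mul_apply, vacuum_apply, mehlerFn_apply hβ]
      rw [← Complex.ofReal_mul]
      exact Complex.ofReal_re _
    rw [integral_pos_iff_support_of_nonneg (fun x => (hpos x).le) hint]
    have : Function.support (fun x => v x * mehler β x y) = Set.univ :=
      Set.eq_univ_of_forall fun x => (hpos x).ne'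
    simp [this]
  simp only [h1, h0] at h
  have hz : Lp.toTemperedDistribution (0 : H) vacuum = ((0 : ℝ) : ℂ) := by
    have := map_zero (Lp.toTemperedDistributionCLM ℂ (volume : Measure ℝ) 2)
    rw [Lp.toTemperedDistributionCLM_apply] at this
    rw [this]
    simp
  rw [hz, Complex.hasSum_ofReal, hasSum_zero_iff_of_nonneg fun s => (h2 _).le] at h
  exact (h2 _).ne' (congrFun h 0)

/-! ### Approximation 3: the damped ideal state -/

/-- Each of the two Fock factors may grow like e^{βn/4}; the damping e^{-βn} pays for both and
leaves a geometric series of ratio e^{-β/2}. -/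
theorem exp_mul_mul_exp_le {β B B' a : ℝ} (hβ : 0 < β) (hB : 0 ≤ B) (ha : 0 ≤ a)
    (n : ℕ) {u v : ℝ} (hu0 : 0 ≤ u) (hv0 : 0 ≤ v)
    (hu : u ≤ B * Real.exp (β / 4 * n) * a) (hv : v ≤ B' * Real.exp (β / 4 * n)) :
    Real.exp (-β * (n + 1 / 2)) * u * v ≤ B * B' * Real.exp (-(β / 2)) ^ n * a := by
  have h : Real.exp (-β * (n + 1 / 2)) ≤ Real.exp (-β * n) := by
    refine Real.exp_le_exp.2 ?_
    nlinarith
  calc Real.exp (-β * (n + 1 / 2)) * u * v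
      ≤ Real.exp (-β * n) * (B * Real.exp (β / 4 * n) * a) * (B' * Real.exp (β / 4 * n)) := by
        gcongr
    _ = B * B' * (Real.exp (-β * n) * Real.exp (β / 4 * n) * Real.exp (β / 4 * n)) * a := by ring
    _ = _ := by
        rw [← Real.exp_add, ← Real.exp_add, ← Real.exp_nat_mul]
        ring_nf

theorem summable_exp_neg_pow {β : ℝ} (hβ : 0 < β) :
    Summable fun n : ℕ => Real.exp (-(β / 2)) ^ n :=
  summable_geometric_of_lt_one (Real.exp_pos _).le (by simpa using hβ)

/-- The double family underlying `e^{-β(n̂+1/2)}` applied to a superposition of position kets. -/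
noncomputable def fockTerm (β y : ℝ) (n : ℕ) : H :=
  ((Real.exp (-β * (n + 1 / 2)) * fockReal n y : ℝ) : ℂ) • ket (fock n)

/-- The bound is a product, geometric in n and Gaussian in y, which makes the double family over ℕ ×
ℤ absolutely summable. -/
theorem norm_fockTerm_le {β : ℝ} (hβ : 0 < β) : ∃ B τ : ℝ, 0 < τ ∧ ∀ y n,
    ‖fockTerm β y n‖ ≤ B * Real.exp (-(β / 2)) ^ n * Real.exp (-τ * y ^ 2) := by
  obtain ⟨B, τ, hB, hτ, h⟩ := abs_fockReal_le (ε := β / 4) (by positivity)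
  obtain ⟨B', hB', h'⟩ := norm_ket_fock_le (ε := β / 4) (by positivity)
  refine ⟨B * B', τ, hτ, fun y n => ?_⟩
  rw [fockTerm, norm_smul, Complex.norm_real, Real.norm_eq_abs, abs_mul, Real.abs_exp]
  exact exp_mul_mul_exp_le hβ hB.le (Real.exp_pos _).le n (abs_nonneg _) (norm_nonneg _)
    (h n y) (h' n)

theorem hasSum_integral_mehler {β : ℝ} (hβ : 0 < β) (y : ℝ) (f : 𝓢(ℝ, ℂ)) :
    HasSum (fun n : ℕ => ∫ x, f x * ((Real.exp (-β * (n + 1 / 2)) * fockReal n y : ℝ) * fock n x))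
      (∫ x, f x * mehlerFn β y x) := by
  obtain ⟨B, τ, hB, hτ, h⟩ := abs_fockReal_le (ε := β / 4) (by positivity)
  have h' : ∀ n x, |fockReal n x| ≤ B * Real.exp (β / 4 * n) := fun n x => by
    refine (h n x).trans (mul_le_of_le_one_right (by positivity) ?_)
    rw [Real.exp_le_one_iff]
    nlinarith [sq_nonneg x]
  refine hasSum_integral_of_dominated_convergence
    (fun n x => B * B * Real.exp (-(β / 2)) ^ n * ‖f x‖) (fun n => ?_)
    (fun n => ae_of_all _ fun x => ?_) (ae_of_all _ fun x => ?_) ?_ (ae_of_all _ fun x => ?_)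
  · exact (f.continuous.mul (continuous_const.mul (fock n).continuous)).aestronglyMeasurable
  · rw [norm_mul, norm_mul, fock_apply, Complex.norm_real, Complex.norm_real, Real.norm_eq_abs,
      Real.norm_eq_abs, abs_mul, Real.abs_exp, mul_comm]
    refine mul_le_mul_of_nonneg_right ?_ (norm_nonneg _)
    have := exp_mul_mul_exp_le hβ hB.le zero_le_one n (abs_nonneg (fockReal n y))
      (abs_nonneg (fockReal n x)) (by simpa using h' n y) (h' n x)
    simpa using this
  · exact ((summable_exp_neg_pow hβ).mul_left _).mul_right _
  · simp only [tsum_mul_right]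
    exact f.integrable.norm.const_mul _
  · refine HasSum.mul_left _ ?_
    rw [mehlerFn_apply hβ]
    have := Complex.hasSum_ofReal.2 (hasSum_mehler hβ x y)
    refine this.congr_fun fun n => ?_
    rw [fock_apply]
    push_cast
    ring

/-- The norm bound gives convergence in L² to some limit. Testing against Schwartz functions
identifies it, since there the pointwise Mehler series can be integrated term by term. -/
theorem hasSum_fockTerm {β : ℝ} (hβ : 0 < β) (y : ℝ) :
    HasSum (fockTerm β y) (ket (mehlerFn β y)) := by
  obtain ⟨B, τ, -, hB⟩ := norm_fockTerm_le hβ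
  have hs : Summable (fockTerm β y) :=
    Summable.of_norm_bounded (((summable_exp_neg_pow hβ).mul_left _).mul_right _) (hB y)
  convert hs.hasSum using 1
  refine toTemperedDistribution_injective fun f => ?_
  have h := hasSum_toTemperedDistribution hs.hasSum f
  refine HasSum.unique ?_ h
  rw [toTemperedDistribution_ket]
  have he : ∀ n, Lp.toTemperedDistribution (fockTerm β y n) f =
      ∫ x, f x * ((Real.exp (-β * (n + 1 / 2)) * fockReal n y : ℝ) * fock n x) := fun n => by
    rw [fockTerm, ← ket_smul, toTemperedDistribution_ket]
    rfl
  simp only [he]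
  exact hasSum_integral_mehler hβ y f

theorem hasSum_dampTerm {β : ℝ} (hβ : 0 < β) {d : ℕ} (j : Fin d) :
    HasSum (dampTerm β (ideal d j))
      (((Real.sqrt (spacing d * d) : ℝ) : ℂ) • mehlerState d j β) := by
  obtain ⟨B, τ, hτ, hB⟩ := norm_fockTerm_le hβ
  have hs : Summable fun p : ℕ × ℤ => fockTerm β (peak d j p.2) p.1 := by
    refine Summable.of_norm_bounded (((summable_exp_neg_pow hβ).mul_of_nonneg
      (summable_exp_peak j hτ) (fun n => by positivity) (fun s => by positivity)).mul_left B)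
      fun p => ?_
    rw [← mul_assoc]
    exact hB _ _
  -- Summing over n first gives the Mehler kernels and then `mehlerState`; summing over s first, as
  -- below, gives the terms of the damped ideal state.
  have h1 : (∑' p : ℕ × ℤ, fockTerm β (peak d j p.2) p.1) = mehlerState d j β := by
    have hs' : HasSum (fun p : ℤ × ℕ => fockTerm β (peak d j p.1) p.2)
        (∑' p : ℕ × ℤ, fockTerm β (peak d j p.2) p.1) :=
      (Equiv.prodComm ℤ ℕ).hasSum_iff.2 hs.hasSum
    have hf : ∀ s : ℤ, HasSum (fun n => fockTerm β (peak d j s) n)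
        (ket (mehlerFn β (peak d j s))) := fun s => hasSum_fockTerm hβ (peak d j s)
    exact (HasSum.prod_fiberwise hs' hf).unique (hasSum_mehlerState hβ j)
  rw [← h1]
  have h2 := (hs.hasSum.prod_fiberwise fun n => (hs.prod_factor n).hasSum).const_smul
    ((Real.sqrt (spacing d * d) : ℝ) : ℂ)
  have h3 : ∀ n s, ((Real.sqrt (spacing d * d) : ℝ) : ℂ) • fockTerm β (peak d j s) n =
      (((Real.exp (-β * (n + 1 / 2)) : ℝ) : ℂ) *
        (((Real.sqrt (spacing d * d) : ℝ) : ℂ) * fock n (peak d j s))) • ket (fock n) := by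
    intro n s
    rw [fockTerm, fock_apply, smul_smul]
    congr 1
    push_cast
    ring
  have h4 : ∀ n, dampTerm β (ideal d j) n =
      ((Real.sqrt (spacing d * d) : ℝ) : ℂ) • ∑' s, fockTerm β (peak d j s) n := by
    intro n
    have h5 := (hs.prod_factor n).hasSum.const_smul ((Real.sqrt (spacing d * d) : ℝ) : ℂ)
    simp only [h3] at h5
    have h6 := (hasSum_ideal j (fock n)).mul_left ((Real.exp (-β * (n + 1 / 2)) : ℝ) : ℂ)
    rw [dampTerm]
    exact (h6.smul_const (ket (fock n))).unique h5
  simp only [funext h4]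
  exact h2

/-! ### Approximation 2: Gaussian superposition of displacements -/

/-- The contribution of the position ket at `y` to the integrand of Approximation 2. -/
noncomputable def weylTerm (γ δ : ℝ) (f : 𝓢(ℝ, ℂ)) (y : ℝ) (r : ℝ × ℝ) : ℂ :=
  ((1 / (2 * Real.pi * γ * δ) *
      Real.exp (-(r.1 ^ 2 / (2 * γ ^ 2)) - r.2 ^ 2 / (2 * δ ^ 2)) : ℝ) : ℂ) *
    (Complex.exp (-Complex.I * r.1 * r.2 / 2) *
      (Complex.exp (Complex.I * r.1 * (y + r.2 : ℝ)) * f (y + r.2)))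

/-- By transposition, the displaced delta at y evaluates the modulated test function e^{ir₁·}f at y
+ r₂. -/
theorem hasSum_weylTerm {d : ℕ} (j : Fin d) (γ δ : ℝ) (f : 𝓢(ℝ, ℂ)) (r : ℝ × ℝ) :
    HasSum (fun s : ℤ => ((Real.sqrt (spacing d * d) : ℝ) : ℂ) * weylTerm γ δ f (peak d j s) r)
      (approx2Integrand d j γ δ f r) := by
  have h := ((hasSum_ideal j (dispX (-r.2) (dispZ r.1 f))).mul_left
    (Complex.exp (-Complex.I * r.1 * r.2 / 2))).mul_left
    (((1 / (2 * Real.pi * γ * δ) *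
      Real.exp (-(r.1 ^ 2 / (2 * γ ^ 2)) - r.2 ^ 2 / (2 * δ ^ 2)) : ℝ) : ℂ))
  refine h.congr_fun fun s => ?_
  rw [dispX_apply, dispZ_apply, sub_neg_eq_add, weylTerm]
  ring

theorem continuous_weylTerm (γ δ : ℝ) (f : 𝓢(ℝ, ℂ)) (y : ℝ) : Continuous (weylTerm γ δ f y) := by
  have := f.continuous
  unfold weylTerm
  fun_prop

/-- The common dominating function of the integrands `weylTerm γ δ f y`. -/
noncomputable def weylBound (γ δ : ℝ) (r : ℝ × ℝ) : ℝ :=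
  1 / (2 * Real.pi * γ * δ) * (Real.exp (-(r.1 ^ 2 / (2 * γ ^ 2))) *
    (Real.exp (-(r.2 ^ 2 / (2 * δ ^ 2))) * (1 + |r.2|) ^ 2))

theorem integrable_weylBound {γ δ : ℝ} (hγ : γ ≠ 0) (hδ : δ ≠ 0) :
    Integrable (weylBound γ δ) := by
  have h1 : Integrable fun u : ℝ => Real.exp (-(u ^ 2 / (2 * γ ^ 2))) :=
    (integrable_exp_quadratic (s := 1 / (2 * γ ^ 2)) (by positivity) 0).congr
      (ae_of_all _ fun u => by dsimp only; congr 1; ring)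
  -- Half of the Gaussian rate 1/(2δ²): one half absorbs the polynomial weight, the other remains
  -- integrable.
  set τ := 1 / (4 * δ ^ 2) with hτ
  have hτ0 : 0 < τ := by positivity
  have h2 : Integrable fun t : ℝ => Real.exp (-(t ^ 2 / (2 * δ ^ 2))) * (1 + |t|) ^ 2 := by
    refine ((integrable_exp_quadratic hτ0 0).const_mul (2 * (1 + τ⁻¹))).mono'
      (by fun_prop) (ae_of_all _ fun t => ?_)
    rw [Real.norm_of_nonneg (by positivity)]
    calc Real.exp (-(t ^ 2 / (2 * δ ^ 2))) * (1 + |t|) ^ 2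
        ≤ Real.exp (-(t ^ 2 / (2 * δ ^ 2))) * (2 * (1 + τ⁻¹) * Real.exp (τ * t ^ 2)) := by
          gcongr
          exact one_add_abs_sq_le hτ0 t
      _ = 2 * (1 + τ⁻¹) * (Real.exp (-(t ^ 2 / (2 * δ ^ 2))) * Real.exp (τ * t ^ 2)) := by ring
      _ = _ := by
          rw [← Real.exp_add]
          congr 2
          rw [hτ]
          field_simp
          ring
  exact (h1.mul_prod h2).const_mul _

/-- The phases have modulus one. The Peetre-type inequality 1 + |y| ≤ (1 + |y + r₂|)(1 + |r₂|) moves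
the decay of f from y + r₂ to y, so the bound factors into an integrable function of r and a
summable function of y. -/
theorem norm_weylTerm_le {γ δ : ℝ} (hγδ : 0 < γ * δ) {f : 𝓢(ℝ, ℂ)} {C : ℝ} (hC : 0 ≤ C)
    (hf : ∀ x, ‖f x‖ ≤ C * ((1 + |x|) ^ 2)⁻¹) (y : ℝ) (r : ℝ × ℝ) :
    ‖weylTerm γ δ f y r‖ ≤ C * weylBound γ δ r * ((1 + |y|) ^ 2)⁻¹ := by
  have h0 : 0 < 1 / (2 * Real.pi * γ * δ) := by
    rw [mul_assoc]
    positivity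
  have e1 : ‖Complex.exp (-Complex.I * r.1 * r.2 / 2)‖ = 1 := by
    rw [show -Complex.I * r.1 * r.2 / 2 = ((-(r.1 * r.2 / 2) : ℝ) : ℂ) * Complex.I by
      push_cast; ring, Complex.norm_exp_ofReal_mul_I]
  have e2 : ‖Complex.exp (Complex.I * r.1 * (y + r.2 : ℝ))‖ = 1 := by
    rw [show Complex.I * r.1 * (y + r.2 : ℝ) = ((r.1 * (y + r.2) : ℝ) : ℂ) * Complex.I by
      push_cast; ring, Complex.norm_exp_ofReal_mul_I]
  have h1 : ((1 + |y + r.2|) ^ 2)⁻¹ ≤ (1 + |r.2|) ^ 2 * ((1 + |y|) ^ 2)⁻¹ := by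
    rw [← div_eq_mul_inv, le_div_iff₀ (by positivity), inv_mul_le_iff₀ (by positivity), ← mul_pow]
    gcongr
    have : |y| ≤ |y + r.2| + |r.2| := by
      calc |y| = |(y + r.2) - r.2| := by ring_nf
        _ ≤ _ := abs_sub _ _
    nlinarith [mul_nonneg (abs_nonneg (y + r.2)) (abs_nonneg r.2)]
  rw [weylTerm, norm_mul, norm_mul, norm_mul, e1, e2, one_mul, one_mul, Complex.norm_real,
    Real.norm_of_nonneg (by positivity), weylBound, sub_eq_add_neg, Real.exp_add]
  calc _ ≤ 1 / (2 * Real.pi * γ * δ) * (Real.exp (-(r.1 ^ 2 / (2 * γ ^ 2))) *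
        Real.exp (-(r.2 ^ 2 / (2 * δ ^ 2)))) *
          (C * ((1 + |r.2|) ^ 2 * ((1 + |y|) ^ 2)⁻¹)) := by
        gcongr
        exact (hf _).trans (by gcongr)
    _ = _ := by ring

theorem integrable_weylTerm {γ δ : ℝ} (hγδ : 0 < γ * δ) (f : 𝓢(ℝ, ℂ)) (y : ℝ) :
    Integrable (weylTerm γ δ f y) := by
  obtain ⟨C, hC, hf⟩ := exists_decay f
  exact (((integrable_weylBound (left_ne_zero_of_mul hγδ.ne')
    (right_ne_zero_of_mul hγδ.ne')).const_mul C).mul_const _).mono'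
    (continuous_weylTerm γ δ f y).aestronglyMeasurable
    (ae_of_all _ fun r => norm_weylTerm_le hγδ hC hf y r)

theorem integrable_approx2Integrand {γ δ : ℝ} (hγδ : 0 < γ * δ) {d : ℕ} (j : Fin d)
    (f : 𝓢(ℝ, ℂ)) : Integrable (approx2Integrand d j γ δ f) ∧
      HasSum (fun s : ℤ => ((Real.sqrt (spacing d * d) : ℝ) : ℂ) *
        ∫ r, weylTerm γ δ f (peak d j s) r) (∫ r, approx2Integrand d j γ δ f r) := by
  obtain ⟨C, hC, hf⟩ := exists_decay f
  set c : ℝ := Real.sqrt (spacing d * d) with hc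
  have hb : ∀ (s : ℤ) r, ‖(c : ℂ) * weylTerm γ δ f (peak d j s) r‖ ≤
      c * (C * weylBound γ δ r) * ((1 + |peak d j s|) ^ 2)⁻¹ := fun s r => by
    rw [norm_mul, Complex.norm_real, Real.norm_of_nonneg (Real.sqrt_nonneg _), mul_assoc c]
    exact mul_le_mul_of_nonneg_left (norm_weylTerm_le hγδ hC hf _ r) (Real.sqrt_nonneg _)
  have hW : Integrable fun r => c * (C * weylBound γ δ r) :=
    ((integrable_weylBound (left_ne_zero_of_mul hγδ.ne')
      (right_ne_zero_of_mul hγδ.ne')).const_mul C).const_mul c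
  have hm : ∀ s : ℤ, Continuous fun r => (c : ℂ) * weylTerm γ δ f (peak d j s) r :=
    fun s => continuous_const.mul (continuous_weylTerm γ δ f _)
  constructor
  · refine (hW.mul_const (∑' s : ℤ, ((1 + |peak d j s|) ^ 2)⁻¹)).mono' ?_
      (ae_of_all _ fun r => ?_)
    · refine aestronglyMeasurable_of_tendsto_ae (u := (atTop : Filter (Finset ℤ)))
        (f := fun S r => ∑ s ∈ S, (c : ℂ) * weylTerm γ δ f (peak d j s) r)
        (fun S => (continuous_finsetSum S fun s _ => hm s).aestronglyMeasurable)
        (ae_of_all _ fun r => hasSum_weylTerm j γ δ f r)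
    · rw [← (hasSum_weylTerm j γ δ f r).tsum_eq]
      exact tsum_of_norm_bounded ((summable_peak j).hasSum.mul_left _) fun s => hb s r
  · have := hasSum_integral_of_dominated_convergence
      (F := fun (s : ℤ) r => (c : ℂ) * weylTerm γ δ f (peak d j s) r)
      (fun s r => c * (C * weylBound γ δ r) * ((1 + |peak d j s|) ^ 2)⁻¹)
      (fun s => (hm s).aestronglyMeasurable) (fun s => ae_of_all _ (hb s))
      (ae_of_all _ fun r => (summable_peak j).mul_left _)
      (by simp only [tsum_mul_left]; exact hW.mul_const _)
      (ae_of_all _ fun r => hasSum_weylTerm j γ δ f r)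
    simpa only [integral_const_mul] using this

/-- The proportionality constant between the Gaussian superposition of displacements and the
Mehler kernel. -/
noncomputable def weylConst (β γ δ : ℝ) : ℝ :=
  1 / (2 * Real.pi * γ * δ) * Real.sqrt (2 * Real.pi * γ ^ 2) *
    Real.sqrt (2 * Real.pi * Real.sinh β)

theorem weylConst_pos {β γ δ : ℝ} (hβ : 0 < β) (hγδ : 0 < γ * δ) : 0 < weylConst β γ δ := by
  have h0 : 0 < 1 / (2 * Real.pi * γ * δ) := by
    rw [mul_assoc]
    positivity
  have := Real.sinh_pos_iff.2 hβ
  have := left_ne_zero_of_mul hγδ.ne'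
  unfold weylConst
  positivity

/-- With t = tanh(β/2) the exponent is -(x - y)²/(4t) - t(x + y)²/4. It is the Mehler exponent
because 1/t + t = 2 coth β and 1/t - t = 2/sinh β. -/
theorem exp_mul_exp_eq_mehler {β γ δ : ℝ} (hβ : 0 < β) (hγ2 : γ ^ 2 = 2 * Real.tanh (β / 2))
    (hδ2 : δ ^ 2 = 2 * Real.tanh (β / 2)) (x y : ℝ) :
    Real.exp (-((x - y) ^ 2 / (2 * δ ^ 2))) * Real.exp (-(γ ^ 2 * ((x + y) / 2) ^ 2 / 2)) =
      Real.sqrt (2 * Real.pi * Real.sinh β) * mehler β x y := by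
  have hs : 0 < Real.sinh (β / 2) := Real.sinh_pos_iff.2 (by linarith)
  have hc := Real.cosh_pos (β / 2)
  have h2s : Real.sinh β = 2 * Real.sinh (β / 2) * Real.cosh (β / 2) := by
    rw [← Real.sinh_two_mul]; ring_nf
  have h2c : Real.cosh β = Real.cosh (β / 2) ^ 2 + Real.sinh (β / 2) ^ 2 := by
    rw [← Real.cosh_two_mul]; ring_nf
  have hsβ : 0 < Real.sinh β := Real.sinh_pos_iff.2 hβ
  have hq : Real.sqrt (2 * Real.pi * Real.sinh β) ≠ 0 := by positivity
  rw [mehler, mul_inv_cancel_left₀ hq, ← Real.exp_add, hγ2, hδ2, Real.tanh_eq_sinh_div_cosh,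
    h2s, h2c]
  congr 1
  field_simp
  linear_combination (2 * x * y) * Real.cosh_sq (β / 2)

/-- At fixed r₂ = t the r₁-integral is a Gaussian Fourier transform. The symmetric-ordering phase
e^{-ir₁r₂/2} puts its frequency at y + t/2, the midpoint of y and x = y + t. -/
theorem integral_weylTerm {β γ δ : ℝ} (hβ : 0 < β) (hγδ : 0 < γ * δ)
    (hγ2 : γ ^ 2 = 2 * Real.tanh (β / 2)) (hδ2 : δ ^ 2 = 2 * Real.tanh (β / 2))
    (f : 𝓢(ℝ, ℂ)) (y : ℝ) :
    ∫ r, weylTerm γ δ f y r = (weylConst β γ δ : ℂ) * ∫ x, f x * mehlerFn β y x := by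
  have hγ : γ ≠ 0 := left_ne_zero_of_mul hγδ.ne'
  have hi := integrable_weylTerm hγδ f y
  rw [Measure.volume_eq_prod] at hi ⊢
  -- The outer variable is r₂; on the right-hand side x is translated by y so that t = x - y is
  -- integrated on both sides.
  rw [integral_prod_symm _ hi, ← integral_const_mul,
    ← integral_add_left_eq_self (fun x => (weylConst β γ δ : ℂ) * (f x * mehlerFn β y x)) y]
  refine integral_congr_ae (ae_of_all _ fun t => ?_)
  dsimp only
  have h1 : ∀ u : ℝ, weylTerm γ δ f y (u, t) =
      ((1 / (2 * Real.pi * γ * δ) * Real.exp (-(t ^ 2 / (2 * δ ^ 2))) : ℝ) * f (y + t)) *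
        Complex.exp (-(1 / (2 * γ ^ 2) : ℝ) * u ^ 2 + (Complex.I * (y + t / 2)) * u + 0) := by
    intro u
    have : Complex.exp (-(1 / (2 * γ ^ 2) : ℝ) * u ^ 2 + (Complex.I * (y + t / 2)) * u + 0) =
        (Real.exp (-(u ^ 2 / (2 * γ ^ 2))) : ℝ) * (Complex.exp (-Complex.I * u * t / 2) *
          Complex.exp (Complex.I * u * (y + t : ℝ))) := by
      rw [Complex.ofReal_exp, ← Complex.exp_add, ← Complex.exp_add]
      congr 1
      push_cast
      ring
    rw [this, weylTerm, sub_eq_add_neg, Real.exp_add]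
    push_cast
    ring
  simp only [h1]
  rw [integral_const_mul, integral_gaussian_affine (by positivity), mehlerFn_apply hβ]
  have h2 : Complex.exp (0 + (Complex.I * (y + t / 2)) ^ 2 / (4 * (1 / (2 * γ ^ 2) : ℝ))) =
      (Real.exp (-(γ ^ 2 * ((y + t + y) / 2) ^ 2 / 2)) : ℝ) := by
    rw [Complex.ofReal_exp, mul_pow, Complex.I_sq]
    congr 1
    push_cast
    have : (γ : ℂ) ≠ 0 := Complex.ofReal_ne_zero.2 hγ
    field_simp
    ring
  have h3 : Real.pi / (1 / (2 * γ ^ 2)) = 2 * Real.pi * γ ^ 2 := by field_simp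
  have h4 := exp_mul_exp_eq_mehler hβ hγ2 hδ2 (y + t) y
  rw [add_sub_cancel_left] at h4
  rw [h2, h3, weylConst]
  have h5 := congrArg (fun z : ℝ => (z : ℂ)) h4
  push_cast at h5 ⊢
  linear_combination (1 / (2 * Real.pi * γ * δ) * (Real.sqrt (2 * Real.pi * γ ^ 2) : ℂ) *
    f (y + t)) * h5

theorem isApprox2Integral_mehlerState {β γ δ : ℝ} (hβ : 0 < β) (hγδ : 0 < γ * δ)
    (hγ2 : γ ^ 2 = 2 * Real.tanh (β / 2)) (hδ2 : δ ^ 2 = 2 * Real.tanh (β / 2))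
    {d : ℕ} (j : Fin d) :
    IsApprox2Integral d j γ δ
      (((Real.sqrt (spacing d * d) * weylConst β γ δ : ℝ) : ℂ) • mehlerState d j β) := by
  intro f
  have h := hasSum_toTemperedDistribution ((hasSum_mehlerState hβ j).const_smul
    ((Real.sqrt (spacing d * d) * weylConst β γ δ : ℝ) : ℂ)) f
  refine h.unique ((integrable_approx2Integrand hγδ j f).2.congr_fun fun s => ?_)
  rw [← ket_smul, toTemperedDistribution_ket, integral_weylTerm hβ hγδ hγ2 hδ2, ← mul_assoc,
    ← Complex.ofReal_mul, ← integral_const_mul]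
  refine integral_congr_ae (ae_of_all _ fun x => ?_)
  simp only [smul_apply, smul_eq_mul]
  ring

theorem IsApprox2Integral.unique {d : ℕ} {j : Fin d} {γ δ : ℝ} {φ ψ : H}
    (hφ : IsApprox2Integral d j γ δ φ) (hψ : IsApprox2Integral d j γ δ ψ) : φ = ψ :=
  toTemperedDistribution_injective fun f => (hφ f).trans (hψ f).symm

theorem approx2Integral_eq {d : ℕ} {j : Fin d} {γ δ : ℝ} {ψ : H}
    (hψ : IsApprox2Integral d j γ δ ψ) : approx2Integral d j γ δ = ψ := by
  have h : ∃ ψ, IsApprox2Integral d j γ δ ψ := ⟨ψ, hψ⟩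
  rw [approx2Integral, dif_pos h]
  exact h.choose_spec.unique hψ

theorem normalize_ofReal_smul {r : ℝ} (hr : 0 < r) (ψ : H) :
    NormedSpace.normalize ((r : ℂ) • ψ) = NormedSpace.normalize ψ :=
  NormedSpace.normalize_smul_of_pos hr ψ

/-! ### The parameters -/

/-- With t = tanh(β/2), λ = 1 + t² and this is the double-angle formula 2t/(1 + t²) = tanh β. -/
theorem div_lam_eq_tanh {β γ δ : ℝ} (hγ2 : γ ^ 2 = 2 * Real.tanh (β / 2))
    (hδ2 : δ ^ 2 = 2 * Real.tanh (β / 2)) : γ ^ 2 / lam γ δ = Real.tanh β := by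
  have hc := Real.cosh_pos (β / 2)
  have h2s : Real.sinh β = 2 * Real.sinh (β / 2) * Real.cosh (β / 2) := by
    rw [← Real.sinh_two_mul]; ring_nf
  have h2c : Real.cosh β = Real.cosh (β / 2) ^ 2 + Real.sinh (β / 2) ^ 2 := by
    rw [← Real.cosh_two_mul]; ring_nf
  rw [lam, hγ2, hδ2, Real.tanh_eq_sinh_div_cosh, Real.tanh_eq_sinh_div_cosh, h2s, h2c]
  field_simp
  ring

/-- In the same variable the left side is (1 - t²)/(1 + t²) = 1/cosh β. -/
theorem one_sub_div_lam {β γ δ : ℝ} (hγ2 : γ ^ 2 = 2 * Real.tanh (β / 2))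
    (hδ2 : δ ^ 2 = 2 * Real.tanh (β / 2)) :
    1 - γ ^ 2 * δ ^ 2 / (2 * lam γ δ) = (Real.cosh β)⁻¹ := by
  have hc := Real.cosh_pos (β / 2)
  have h2c : Real.cosh β = Real.cosh (β / 2) ^ 2 + Real.sinh (β / 2) ^ 2 := by
    rw [← Real.cosh_two_mul]; ring_nf
  have h1 : 0 < Real.cosh (β / 2) ^ 2 + Real.sinh (β / 2) ^ 2 := by positivity
  rw [lam, hγ2, hδ2, Real.tanh_eq_sinh_div_cosh, h2c]
  field_simp
  linear_combination
    4 * (Real.cosh (β / 2) ^ 2 + Real.sinh (β / 2) ^ 2) * Real.cosh_sq (β / 2)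

end GKP

/-! ### Assembly of the equivalence -/

theorem theorem1 (d : ℕ) (j : Fin d) (κ Δ γ δ β : ℝ)
    (hκ : 0 < κ) (hΔ : 0 < Δ) (hγδ : 0 < γ * δ) (hβ : 0 < β)
    (hγ2 : γ ^ 2 = 2 * Real.tanh (β / 2)) (hδ2 : δ ^ 2 = 2 * Real.tanh (β / 2))
    (hκ2 : κ ^ 2 = γ ^ 2 / GKP.lam γ δ)
    (hΔ2 : Δ ^ 2 = δ ^ 2 / GKP.lam γ δ *
      ((1 - γ ^ 2 * δ ^ 2 / (2 * GKP.lam γ δ)) ^ 2)⁻¹) :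
    -- the prescriptions for the parameters agree and are admissible
    (γ ^ 2 / GKP.lam γ δ = Real.tanh β ∧
      δ ^ 2 / GKP.lam γ δ * ((1 - γ ^ 2 * δ ^ 2 / (2 * GKP.lam γ δ)) ^ 2)⁻¹ =
        Real.sinh β * Real.cosh β ∧
      γ * δ < 2) ∧
    -- the ideal state and the three approximations are well defined
    (Summable (fun s : ℤ =>
        (TemperedDistribution.delta (GKP.peak d j s) : TemperedDistribution ℝ ℂ)) ∧
      Summable (GKP.approx1Term d j κ Δ) ∧
      (∀ f, MeasureTheory.Integrable (GKP.approx2Integrand d j γ δ f)) ∧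
      (∃! ψ, GKP.IsApprox2Integral d j γ δ ψ) ∧
      Summable (GKP.dampTerm β (GKP.ideal d j)) ∧
      ‖GKP.approx1 d j κ Δ‖ = 1 ∧ ‖GKP.approx2 d j γ δ‖ = 1 ∧ ‖GKP.approx3 d j β‖ = 1) ∧
    -- the three states agree
    GKP.squeezeH (Real.log (Real.sqrt (1 + κ ^ 2 * Δ ^ 2))) (GKP.approx1 d j κ Δ) =
        GKP.approx2 d j γ δ ∧
      GKP.approx2 d j γ δ = GKP.approx3 d j β := by
  have hc := Real.cosh_pos β
  have p1 := GKP.div_lam_eq_tanh hγ2 hδ2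
  have p2 : δ ^ 2 / GKP.lam γ δ * ((1 - γ ^ 2 * δ ^ 2 / (2 * GKP.lam γ δ)) ^ 2)⁻¹ =
      Real.sinh β * Real.cosh β := by
    rw [GKP.one_sub_div_lam hγ2 hδ2, hδ2, ← hγ2, p1, Real.tanh_eq_sinh_div_cosh]
    field_simp
  have p3 : γ * δ < 2 := by
    have := Real.tanh_lt_one (β / 2)
    -- By the arithmetic-geometric mean inequality, γδ ≤ (γ² + δ²)/2 = 2 tanh(β/2) < 2.
    nlinarith [sq_nonneg (γ - δ)]
  rw [p1] at hκ2
  rw [p2] at hΔ2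
  have hsp : 0 < Real.sqrt (GKP.spacing d * d) := by
    have : (0 : ℝ) < d := by exact_mod_cast j.pos
    have := GKP.spacing_pos j
    positivity
  have hw := GKP.isApprox2Integral_mehlerState hβ hγδ hγ2 hδ2 j
  have e1 := GKP.squeezeH_approx1 hκ hΔ hβ hκ2 hΔ2 j
  have e2 : GKP.approx2 d j γ δ = NormedSpace.normalize (GKP.mehlerState d j β) := by
    rw [GKP.approx2, GKP.approx2Integral_eq hw,
      GKP.normalize_ofReal_smul (mul_pos hsp (GKP.weylConst_pos hβ hγδ))]
  have e3 : GKP.approx3 d j β = NormedSpace.normalize (GKP.mehlerState d j β) := by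
    rw [GKP.approx3, GKP.damp, (GKP.hasSum_dampTerm hβ j).tsum_eq,
      GKP.normalize_ofReal_smul hsp]
  have hn := NormedSpace.norm_normalize_eq_one_iff.2 (GKP.mehlerState_ne_zero hβ j)
  refine ⟨⟨p1, p2, p3⟩, ⟨(GKP.hasSum_delta_peak j).summable, GKP.summable_approx1Term j hκ Δ,
    fun f => (GKP.integrable_approx2Integrand hγδ j f).1,
    ⟨_, hw, fun ψ hψ => hψ.unique hw⟩, (GKP.hasSum_dampTerm hβ j).summable, ?_, ?_, ?_⟩, ?_, ?_⟩
  -- The norm is read off after squeezing, where the state is the normalized Mehler sum, already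
  -- known to be non-zero.
  · rw [← GKP.norm_squeezeH (Real.log (Real.sqrt (1 + κ ^ 2 * Δ ^ 2))), e1, hn]
  · rw [e2, hn]
  · rw [e3, hn]
  · rw [e1, e2]
  · rw [e2, e3]
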